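/- Let $V$ be a simple vertex algebra over $\mathbb{C}$ (nonzero, with no ideals other than $0$ and $V$) of countable dimension, let $G$ be a finite group of automorphisms of $V$, and let $\sigma$ be an element of the center of $G$, of order $T$. For $0\le r<T$ put $V^r=\{v\in V : \sigma v=e^{-2\pi i r/T}v\}$. A $\sigma$-twisted $V$-module is a complex vector space $M$ with a linear map $v\mapsto Y_M(v,z)=\sum_{n\in\frac1T\mathbb{Z}}v_nz^{-n-1}$, $v_n\in\operatorname{End}M$, such that for $u\in V^r$, $v\in V$, $w\in M$: $u_n=0$ unless $n\in\frac rT+\mathbb{Z}$; $u_nw=0$ for $n$ sufficiently large; $Y_M(\mathbf 1,z)=\mathrm{Id}_M$; and $$z_0^{-1}\delta\Big(\frac{z_1-z_2}{z_0}\Big)Y_M(u,z_1)Y_M(v,z_2)-z_0^{-1}\delta\Big(\frac{z_2-z_1}{-z_0}\Big)Y_M(v,z_2)Y_M(u,z_1)=z_2^{-1}\Big(\frac{z_1-z_0}{z_2}\Big)^{-r/T}\delta\Big(\frac{z_1-z_0}{z_2}\Big)Y_M(Y(u,z_0)v,z_2).$$ Let $M$ be an irreducible $\sigma$-twisted $V$-module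 that is $G$-stable, that is, for every $g\in G$ it is isomorphic to the $\sigma$-twisted module $M\cdot g$, which is the space $M$ with $Y_{M\cdot g}(v,z)=Y_M(gv,z)$. Then there are linear automorphisms $\phi(g)$ of $M$, $g\in G$, with $\phi(1)=\mathrm{Id}_M$ and $\phi(g)Y_M(v,z)\phi(g)^{-1}=Y_M(gv,z)$ for all $v\in V$. For every such family $\phi$ there is a $2$-cocycle $\alpha_M:G\times G\to\mathbb{C}^{\times}$, normalized by $\alpha_M(1,g)=\alpha_M(g,1)=1$, with $\phi(g)\phi(h)=\alpha_M(g,h)\phi(gh)$ for all $g,h\in G$. The twisted group algebra $\mathbb{C}^{\alpha_M}[G]=\bigoplus_{g\in G}\mathbb{C}\bar g$, with $\bar g\bar h=\alpha_M(g,h)\overline{gh}$, is semisimple and acts on $M$ by $\bar g\mapsto\phi(g)$, and this action commutes with the action on $M$ of the vertex algebra $V^G=\{v\in V: gv=v \text{ for all } g\in G\}$. Let $(W_\lambda)_{\lambda\in\Lambda_M}$ be a complete list, without repetitions, of the irreducible $\mathbb{C}^{\alpha_M}[G]$-modules up to isomorphism, and let $M_\lambda=\operatorname{Hom}_{\mathbb{C}^{\alpha_M}[G]}(W_\lambda,M)$,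 with the $V^G$-module structure $(v_nf)(w)=v_n(f(w))$. Then $w\otimes f\mapsto f(w)$ defines an isomorphism of $\mathbb{C}^{\alpha_M}[G]\otimes V^G$-modules $$\bigoplus_{\lambda\in\Lambda_M}W_\lambda\otimes M_\lambda\;\cong\; M,$$ and moreover: 1. $M_\lambda$ is nonzero for every $\lambda\in\Lambda_M$; 2. every $M_\lambda$ is an irreducible $V^G$-module; 3. for $\lambda,\mu\in\Lambda_M$, the $V^G$-modules $M_\lambda$ and $M_\mu$ are isomorphic if and only if $\lambda=\mu$. -/

import Mathlib

open scoped TensorProduct DirectSum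

universe u v w x

/-! ### Vertex algebras -/

/-- A vertex algebra over `ℂ`, through the modes of its vertex operators: `mode u n` is the
coefficient `u_n` in `Y(u, z) = ∑ u_n z^(-n-1)`. The field `jacobi` is the coefficient of
`z₀^(-l-1) z₁^(-m-1) z₂^(-n-1)` of the Jacobi identity, applied to a vector `w`; by truncation only
finitely many terms of each sum are nonzero. -/
class VertexAlgebra (V : Type u) [AddCommGroup V] [Module ℂ V] where
  /-- `mode u n = u_n`. -/
  mode : V →ₗ[ℂ] ℤ → Module.End ℂ V
  /-- The vacuum vector. -/
  vac : V
  truncation : ∀ u v : V, ∃ N : ℤ, ∀ n : ℤ, N ≤ n → mode u n v = 0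
  vac_mode : ∀ n : ℤ, mode vac n = if n = -1 then 1 else 0
  creation : ∀ v : V, ∀ n : ℤ, 0 ≤ n → mode v n vac = 0
  creation_lim : ∀ v : V, mode v (-1) vac = v
  jacobi : ∀ (u v w : V) (l m n : ℤ),
    ∑ᶠ i : ℕ, ((-1 : ℂ) ^ i * ((Ring.choose l i : ℤ) : ℂ)) •
        (mode u (m + l - i) (mode v (n + i) w) -
          ((-1 : ℂ) ^ l) • mode v (n + l - i) (mode u (m + i) w)) =
      ∑ᶠ i : ℕ, ((Ring.choose m i : ℤ) : ℂ) • mode (mode u (l + i) v) (m + n - i) w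

namespace VertexAlgebra

variable (V : Type u) [AddCommGroup V] [Module ℂ V] [VertexAlgebra V]

/-- An ideal of a vertex algebra: a subspace stable under all `v_n`, and such that `w_n v`
belongs to it for all `w` in it and all `v`. -/
def IsIdeal (I : Submodule ℂ V) : Prop :=
  ∀ (v : V) (n : ℤ), ∀ w ∈ I, mode v n w ∈ I ∧ mode w n v ∈ I

/-- A vertex algebra is simple if it is nonzero and its only ideals are `0` and itself. -/
def IsSimple : Prop :=
  Nontrivial V ∧ ∀ I : Submodule ℂ V, IsIdeal V I → I = ⊥ ∨ I = ⊤

/-- The group of automorphisms of a vertex algebra, inside the general linear group: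
`g 1 = 1` and `g Y(u, z) g⁻¹ = Y(g u, z)`. -/
def autSubgroup : Subgroup (V ≃ₗ[ℂ] V) where
  carrier := {g | g (vac : V) = vac ∧
    ∀ (u v : V) (n : ℤ), g (mode u n v) = mode (g u) n (g v)}
  one_mem' := ⟨rfl, fun _ _ _ => rfl⟩
  mul_mem' := by
    rintro a b ⟨ha, ha'⟩ ⟨hb, hb'⟩
    exact ⟨by simp [ha, hb], fun u v n => by simp [ha', hb']⟩
  inv_mem' := by
    rintro a ⟨ha, ha'⟩
    refine ⟨?_, fun u v n => ?_⟩
    · change a.symm vac = vac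
      rw [LinearEquiv.symm_apply_eq, ha]
    · change a.symm _ = mode (a.symm u) n (a.symm v)
      rw [LinearEquiv.symm_apply_eq, ha']
      simp

/-- The automorphism group of a vertex algebra. -/
abbrev Aut : Type u := ↥(autSubgroup V)

variable {V}

theorem aut_vac (g : Aut V) : (g : V ≃ₗ[ℂ] V) (vac : V) = vac := g.2.1

theorem aut_mode (g : Aut V) (u v : V) (n : ℤ) :
    (g : V ≃ₗ[ℂ] V) (mode u n v) =
      mode ((g : V ≃ₗ[ℂ] V) u) n ((g : V ≃ₗ[ℂ] V) v) := g.2.2 u v n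

/-- The space `V^r` of all `v` with `g v = e^(-2πi r/T) v`, where `T` is the order of `g`. -/
noncomputable def eigen (g : Aut V) (r : ℕ) : Submodule ℂ V :=
  Module.End.eigenspace ((g : V ≃ₗ[ℂ] V) : V →ₗ[ℂ] V)
    (Complex.exp (-2 * Real.pi * Complex.I * r / orderOf g))

theorem mem_eigen (g : Aut V) (r : ℕ) (v : V) :
    v ∈ eigen g r ↔ (g : V ≃ₗ[ℂ] V) v =
      Complex.exp (-2 * Real.pi * Complex.I * r / orderOf g) • v := by
  simp [eigen]

theorem mem_eigen_zero (g : Aut V) (v : V) : v ∈ eigen g 0 ↔ (g : V ≃ₗ[ℂ] V) v = v := by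
  simp [mem_eigen]

/-- The fixed point space `V^G`. -/
def fixedPoints (G : Subgroup (Aut V)) : Submodule ℂ V where
  carrier := {v | ∀ g ∈ G, (g : V ≃ₗ[ℂ] V) v = v}
  add_mem' := fun ha hb g hg => by rw [map_add, ha g hg, hb g hg]
  zero_mem' := fun _ _ => map_zero _
  smul_mem' := fun c _ ha g hg => by rw [map_smul, ha g hg]

theorem mode_mem_fixedPoints (G : Subgroup (Aut V)) {u v : V} (hu : u ∈ fixedPoints G)
    (hv : v ∈ fixedPoints G) (n : ℤ) : mode u n v ∈ fixedPoints G := by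
  intro g hg
  rw [aut_mode, hu g hg, hv g hg]

/-- `V^G` as a vertex subalgebra of `V`. -/
instance fixedPointsVertexAlgebra (G : Subgroup (Aut V)) :
    VertexAlgebra (fixedPoints G) where
  mode :=
    { toFun := fun u n => (mode (u : V) n).restrict
        (fun _ hv => mode_mem_fixedPoints G u.2 hv n)
      map_add' := fun a b => by
        funext n; ext v; simp
      map_smul' := fun c a => by
        funext n; ext v; simp }
  vac := ⟨vac, fun g _ => aut_vac g⟩
  truncation := fun u v => by
    obtain ⟨N, hN⟩ := truncation (u : V) (v : V)
    exact ⟨N, fun n hn => Subtype.ext (hN n hn)⟩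
  vac_mode := fun n => by
    ext v
    have h := vac_mode (V := V) n
    change mode (vac : V) n (v : V) = _
    rw [h]
    split_ifs <;> rfl
  creation := fun v n hn => Subtype.ext (creation (v : V) n hn)
  creation_lim := fun v => Subtype.ext (creation_lim (v : V))
  jacobi := fun a b c l m n => by
    apply Subtype.val_injective
    have key : ∀ f : ℕ → fixedPoints G,
        ((∑ᶠ i, f i : fixedPoints G) : V) = ∑ᶠ i, (f i : V) := fun f =>
      AddMonoidHom.map_finsum_of_injective ((fixedPoints G).subtype.toAddMonoidHom)
        Subtype.val_injective f
    rw [key, key]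
    exact jacobi (a : V) (b : V) (c : V) l m n

theorem coe_mode_fixedPoints (G : Subgroup (Aut V)) (a b : fixedPoints G) (n : ℤ) :
    ((mode a n b : fixedPoints G) : V) = mode (a : V) n (b : V) := rfl

end VertexAlgebra

open VertexAlgebra

/-! ### Twisted modules -/

/-- A `g`-twisted `V`-module structure on the space `M`, for an automorphism `g` of finite order
`T`, through modes: `mode u n` is the coefficient `u_n` in `Y_M(u, z) = ∑ u_n z^(-n-1)`, where `n`
runs over rational numbers. By `mode_support`, `u_n = 0` unless `n ∈ r/T + ℤ` if `u ∈ V^r`; so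
`u_n = 0` for all `u` unless `n ∈ (1/T)ℤ`. The field `jacobi` is the coefficient of
`z₀^(-l-1) z₁^(-m-1) z₂^(-n-1)` of the twisted Jacobi identity
with the factor `((z₁ - z₀)/z₂)^(-r/T)`, applied to a vector `w`; coefficients with
`m ∉ r/T + ℤ` vanish on both sides. -/
structure TwistedModule (V : Type u) [AddCommGroup V] [Module ℂ V] [VertexAlgebra V] (g : Aut V)
    (M : Type v) [AddCommGroup M] [Module ℂ M] where
  /-- `mode u n = u_n`. -/
  mode : V →ₗ[ℂ] ℚ → Module.End ℂ M
  mode_support : ∀ r < orderOf g, ∀ u ∈ eigen g r, ∀ n : ℚ, mode u n ≠ 0 →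
    ∃ k : ℤ, n = (r : ℚ) / orderOf g + k
  truncation : ∀ (u : V) (w : M), ∃ N : ℚ, ∀ n : ℚ, N ≤ n → mode u n w = 0
  vac_mode : ∀ n : ℚ, mode vac n = if n = -1 then 1 else 0
  jacobi : ∀ r < orderOf g, ∀ u ∈ eigen g r, ∀ (v : V) (w : M) (l : ℤ) (m n : ℚ),
    (∃ k : ℤ, m = (r : ℚ) / orderOf g + k) →
    ∑ᶠ i : ℕ, ((-1 : ℂ) ^ i * ((Ring.choose l i : ℤ) : ℂ)) •
        (mode u (m + l - i) (mode v (n + i) w) -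
          ((-1 : ℂ) ^ l) • mode v (n + l - i) (mode u (m + i) w)) =
      ∑ᶠ i : ℕ, Ring.choose (m : ℂ) i • mode (VertexAlgebra.mode u (l + i) v) (m + n - i) w

namespace TwistedModule

variable {V : Type u} [AddCommGroup V] [Module ℂ V] [VertexAlgebra V] {g : Aut V}
  {M : Type v} [AddCommGroup M] [Module ℂ M]

/-- A twisted module is irreducible if it is nonzero and has no submodule except `0` and itself. -/
def IsIrreducible (Y : TwistedModule V g M) : Prop :=
  Nontrivial M ∧ ∀ N : Submodule ℂ M,
    (∀ (a : V) (n : ℚ), ∀ w ∈ N, Y.mode a n w ∈ N) → N = ⊥ ∨ N = ⊤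

/-- Two `g`-twisted modules are isomorphic. -/
def Isomorphic {M' : Type w} [AddCommGroup M'] [Module ℂ M'] (Y : TwistedModule V g M)
    (Y' : TwistedModule V g M') : Prop :=
  ∃ e : M ≃ₗ[ℂ] M', ∀ (a : V) (n : ℚ) (w : M), e (Y.mode a n w) = Y'.mode a n (e w)

theorem map_mem_eigen {h : Aut V} (hc : Commute h g) {r : ℕ} {a : V} (ha : a ∈ eigen g r) :
    (h : V ≃ₗ[ℂ] V) a ∈ eigen g r := by
  rw [mem_eigen] at ha ⊢
  have h1 : (g : V ≃ₗ[ℂ] V) ((h : V ≃ₗ[ℂ] V) a) = (h : V ≃ₗ[ℂ] V) ((g : V ≃ₗ[ℂ] V) a) := by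
    have h2 := congrArg (fun k : Aut V => (k : V ≃ₗ[ℂ] V) a) hc.eq
    exact h2.symm
  rw [h1, ha, map_smul]

/-- The twisted module `M · h`, for `h` commuting with `g`: the space `M` with
`Y_{M·h}(v, z) = Y_M(h v, z)`. -/
def twist (Y : TwistedModule V g M) (h : Aut V) (hc : Commute h g) : TwistedModule V g M where
  mode := Y.mode ∘ₗ ((h : V ≃ₗ[ℂ] V) : V →ₗ[ℂ] V)
  mode_support := fun r hr a ha n hn =>
    Y.mode_support r hr _ (map_mem_eigen hc ha) n hn
  truncation := fun a w => Y.truncation _ w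
  vac_mode := fun n => by
    change Y.mode ((h : V ≃ₗ[ℂ] V) vac) n = _
    rw [aut_vac, Y.vac_mode]
  jacobi := fun r hr a ha b c l m n hm => by
    have key := Y.jacobi r hr _ (map_mem_eigen hc ha) ((h : V ≃ₗ[ℂ] V) b) c l m n hm
    simp only [← aut_mode] at key
    exact key

/-- `M` is `G`-stable: `M` and `M · h` are isomorphic for all `h ∈ G`. -/
def IsStable (G : Subgroup (Aut V)) (σ : G) (hσ : σ ∈ Subgroup.center G)
    (Y : TwistedModule V (σ : Aut V) M) : Prop :=
  ∀ h : G, Isomorphic Y (Y.twist (h : Aut V)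
    (congrArg Subtype.val (Subgroup.mem_center_iff.mp hσ h)))

theorem orderOf_coe_pos {G : Subgroup (Aut V)} [Finite G] (σ : G) : 0 < orderOf (σ : Aut V) := by
  rw [Subgroup.orderOf_coe]
  exact orderOf_pos σ

/-- A `σ`-twisted `V`-module as a module (that is, a `1`-twisted module) for the vertex algebra
`V^G`, if `σ ∈ G`. -/
def restrictFixed {G : Subgroup (Aut V)} [Finite G] {σ : G}
    (Y : TwistedModule V (σ : Aut V) M) : TwistedModule (fixedPoints G) 1 M where
  mode := Y.mode ∘ₗ (fixedPoints G).subtype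
  mode_support := fun r hr a _ n hn => by
    have h0 : (a : V) ∈ eigen (σ : Aut V) 0 := (mem_eigen_zero _ _).2 (a.2 _ σ.2)
    obtain ⟨k, hk⟩ := Y.mode_support 0 (orderOf_coe_pos σ) _ h0 n hn
    refine ⟨k, ?_⟩
    rw [orderOf_one] at hr
    obtain rfl : r = 0 := by omega
    simpa using hk
  truncation := fun a w => Y.truncation _ w
  vac_mode := fun n => Y.vac_mode n
  jacobi := fun r hr a _ b c l m n hm => by
    have h0 : (a : V) ∈ eigen (σ : Aut V) 0 := (mem_eigen_zero _ _).2 (a.2 _ σ.2)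
    rw [orderOf_one] at hr
    obtain rfl : r = 0 := by omega
    exact Y.jacobi 0 (orderOf_coe_pos σ) _ h0 (b : V) c l m n (by simpa using hm)

/-- A family of linear automorphisms `φ(h)` of `M`, for `h ∈ G`, with `φ(1) = id` and
`φ(h) Y_M(v, z) φ(h)⁻¹ = Y_M(h v, z)`. -/
def IsIntertwiningFamily {G : Subgroup (Aut V)} (Y : TwistedModule V g M)
    (φ : G → M ≃ₗ[ℂ] M) : Prop :=
  φ 1 = 1 ∧ ∀ (h : G) (a : V) (n : ℚ) (w : M),
    φ h (Y.mode a n w) = Y.mode (((h : Aut V) : V ≃ₗ[ℂ] V) a) n (φ h w)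

end TwistedModule

/-! ### Modules over an algebra and a vertex algebra, and multiplicity spaces -/

section Multiplicity

variable {A : Type w} [Ring A] [Algebra ℂ A] {M : Type v} [AddCommGroup M] [Module ℂ M]

/-- The multiplicity space `Hom_A(W, M)` of an `A`-module `W` in the `A`-module `M` whose structure
is given by `ρ`. -/
def multiplicitySpace (ρ : A →ₐ[ℂ] Module.End ℂ M) (W : Type x) [AddCommGroup W] [Module ℂ W]
    [Module A W] : Submodule ℂ (W →ₗ[ℂ] M) where
  carrier := {f | ∀ (a : A) (y : W), f (a • y) = ρ a (f y)}
  add_mem' := fun hf hg a y => by simp [hf a y, hg a y]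
  zero_mem' := fun a y => by simp
  smul_mem' := fun c f hf a y => by simp [hf a y]

variable {U : Type u} [AddCommGroup U] [Module ℂ U] [VertexAlgebra U]

/-- The actions of `A` (through `ρ`) and of the vertex algebra `U` on `M` commute, that is, `M` is
an `A ⊗ U`-module. -/
def ActionsCommute (ρ : A →ₐ[ℂ] Module.End ℂ M) (N : TwistedModule U 1 M) : Prop :=
  ∀ (a : A) (b : U) (n : ℚ), Commute (ρ a) (N.mode b n)

theorem finite_support_left {X : Type x} [AddCommGroup X] [Module ℂ X]
    (P Q : ℚ → Module.End ℂ X) (c : X) (hP : ∃ k : ℚ, ∀ n : ℚ, k ≤ n → P n c = 0)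
    (hQ : ∃ k : ℚ, ∀ n : ℚ, k ≤ n → Q n c = 0) (s t : ℕ → ℂ) (p q p' q' : ℚ) :
    (Function.support fun i : ℕ =>
      s i • (P (p - i) (Q (q + i) c) - t i • Q (p' - i) (P (q' + i) c))).Finite := by
  obtain ⟨n₁, h₁⟩ := hQ
  obtain ⟨n₂, h₂⟩ := hP
  obtain ⟨k, hk⟩ := exists_nat_ge (max (n₁ - q) (n₂ - q'))
  refine (Set.finite_Iio k).subset fun i hi => ?_
  by_contra hik
  have hik' : (k : ℚ) ≤ i := by exact_mod_cast not_lt.mp hik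
  have e₁ : n₁ ≤ q + i := by linarith [le_max_left (n₁ - q) (n₂ - q')]
  have e₂ : n₂ ≤ q' + i := by linarith [le_max_right (n₁ - q) (n₂ - q')]
  exact hi (by simp [h₁ _ e₁, h₂ _ e₂])

theorem finite_support_right {X : Type x} [AddCommGroup X] [Module ℂ X]
    (P : U →ₗ[ℂ] ℚ → Module.End ℂ X) (a b : U) (c : X) (s : ℕ → ℂ) (l : ℤ) (p : ℚ) :
    (Function.support fun i : ℕ =>
      s i • P (VertexAlgebra.mode a (l + i) b) (p - i) c).Finite := by
  obtain ⟨n₁, h₁⟩ := VertexAlgebra.truncation a b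
  refine (Set.finite_Iio (n₁ - l).toNat).subset fun i hi => ?_
  by_contra hik
  have e₁ : n₁ ≤ l + i := by
    have : (n₁ - l).toNat ≤ i := not_lt.mp hik
    omega
  exact hi (by simp [h₁ _ e₁])

/-- The operators `(v_n f)(w) = v_n (f w)` on the multiplicity space of `W` in an
`A ⊗ U`-module. -/
def multiplicityMode (ρ : A →ₐ[ℂ] Module.End ℂ M) (N : TwistedModule U 1 M)
    (hcomm : ActionsCommute ρ N) (W : Type x) [AddCommGroup W] [Module ℂ W] [Module A W] :
    U →ₗ[ℂ] ℚ → Module.End ℂ (multiplicitySpace ρ W) where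
  toFun := fun b n =>
    { toFun := fun f => ⟨N.mode b n ∘ₗ f.1, fun a y => by
        have h := congrArg (fun T : Module.End ℂ M => T (f.1 y)) (hcomm a b n).eq
        simp only [LinearMap.comp_apply, f.2 a y]
        exact h.symm⟩
      map_add' := fun f f' => by ext y; simp
      map_smul' := fun c f => by ext y; simp }
  map_add' := fun b b' => by funext n; ext f y; simp
  map_smul' := fun c b => by funext n; ext f y; simp

theorem multiplicityMode_apply (ρ : A →ₐ[ℂ] Module.End ℂ M) (N : TwistedModule U 1 M)
    (hcomm : ActionsCommute ρ N) (W : Type x) [AddCommGroup W] [Module ℂ W] [Module A W]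
    (b : U) (n : ℚ) (f : multiplicitySpace ρ W) (y : W) :
    (multiplicityMode ρ N hcomm W b n f).1 y = N.mode b n (f.1 y) := rfl

theorem multiplicityMode_truncation (ρ : A →ₐ[ℂ] Module.End ℂ M) (N : TwistedModule U 1 M)
    (hcomm : ActionsCommute ρ N) (W : Type x) [AddCommGroup W] [Module ℂ W] [Module A W]
    [FiniteDimensional ℂ W] (b : U) (f : multiplicitySpace ρ W) :
    ∃ k : ℚ, ∀ n : ℚ, k ≤ n → multiplicityMode ρ N hcomm W b n f = 0 := by
  obtain ⟨s, hs⟩ := (Module.Finite.fg_top : (⊤ : Submodule ℂ W).FG)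
  choose k hk using fun y : W => N.truncation b (f.1 y)
  obtain ⟨n₀, h₀⟩ := (s.image k).exists_le
  refine ⟨n₀, fun n hn => Subtype.ext (LinearMap.ext_on hs fun y hy => ?_)⟩
  exact hk y n ((h₀ _ (Finset.mem_image_of_mem k hy)).trans hn)

/-- The `U`-module structure `(v_n f)(w) = v_n (f w)` on the multiplicity space of a finite
dimensional `A`-module `W` in an `A ⊗ U`-module. -/
def multiplicityModule (ρ : A →ₐ[ℂ] Module.End ℂ M) (N : TwistedModule U 1 M)
    (hcomm : ActionsCommute ρ N) (W : Type x) [AddCommGroup W] [Module ℂ W] [Module A W]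
    [FiniteDimensional ℂ W] : TwistedModule U 1 (multiplicitySpace ρ W) where
  mode := multiplicityMode ρ N hcomm W
  mode_support := fun r hr b hb n hn => N.mode_support r hr b hb n fun h0 => hn <| by
    ext f y
    rw [multiplicityMode_apply, h0]; rfl
  truncation := multiplicityMode_truncation ρ N hcomm W
  vac_mode := fun n => by
    ext f y
    rw [multiplicityMode_apply, N.vac_mode]
    split_ifs <;> rfl
  jacobi := fun r hr a ha b f l m n hm => by
    apply Subtype.val_injective
    ext y
    have key : ∀ F : ℕ → multiplicitySpace ρ W, (Function.support F).Finite →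
        (∑ᶠ i, F i).1 y = ∑ᶠ i, (F i).1 y := fun F hF =>
      AddMonoidHom.map_finsum
        (((LinearMap.applyₗ y).comp (multiplicitySpace ρ W).subtype).toAddMonoidHom) hF
    have hT := multiplicityMode_truncation ρ N hcomm W
    rw [key _ (finite_support_left (multiplicityMode ρ N hcomm W a)
        (multiplicityMode ρ N hcomm W b) f (hT a f) (hT b f) _ (fun _ => (-1 : ℂ) ^ l) _ _ _ _),
      key _ (finite_support_right (multiplicityMode ρ N hcomm W) a b f _ l _)]
    exact N.jacobi r hr a ha b (f.1 y) l m n hm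

end Multiplicity

/-! ### Twisted group algebras -/

/-- A normalized `2`-cocycle on `G` with values in `ℂˣ`, with trivial action. -/
structure TwoCocycle (G : Type u) [Group G] where
  /-- The underlying function. -/
  toFun : G → G → ℂˣ
  one_left : ∀ g, toFun 1 g = 1
  one_right : ∀ g, toFun g 1 = 1
  cocycle : ∀ g h k, toFun g h * toFun (g * h) k = toFun g (h * k) * toFun h k

/-- The twisted group algebra `ℂ^α[G]`: it has the basis `ḡ`, `g ∈ G`, and the product
`ḡ h̄ = α(g, h) (gh)‾`. -/
def TwistedGroupAlgebra {G : Type u} [Group G] (_α : TwoCocycle G) : Type u := G →₀ ℂ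

namespace TwistedGroupAlgebra

variable {G : Type u} [Group G] (α : TwoCocycle G)

noncomputable instance : AddCommGroup (TwistedGroupAlgebra α) :=
  inferInstanceAs (AddCommGroup (G →₀ ℂ))

noncomputable instance : Module ℂ (TwistedGroupAlgebra α) :=
  inferInstanceAs (Module ℂ (G →₀ ℂ))

instance [Finite G] : Module.Finite ℂ (TwistedGroupAlgebra α) :=
  inferInstanceAs (Module.Finite ℂ (G →₀ ℂ))

/-- The basis `ḡ` of the twisted group algebra. -/
noncomputable def basis : Module.Basis G ℂ (TwistedGroupAlgebra α) :=
  Module.Basis.ofRepr (LinearEquiv.refl ℂ (G →₀ ℂ))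

/-- The product as a bilinear map. -/
noncomputable def mulMap :
    TwistedGroupAlgebra α →ₗ[ℂ] TwistedGroupAlgebra α →ₗ[ℂ] TwistedGroupAlgebra α :=
  (basis α).constr ℂ fun g => (basis α).constr ℂ fun h =>
    (α.toFun g h : ℂ) • basis α (g * h)

theorem mulMap_basis (g h : G) :
    mulMap α (basis α g) (basis α h) = (α.toFun g h : ℂ) • basis α (g * h) := by
  simp [mulMap, Module.Basis.constr_basis]

theorem mulMap_assoc (a b c : TwistedGroupAlgebra α) :
    mulMap α (mulMap α a b) c = mulMap α a (mulMap α b c) := by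
  have key : (mulMap α).compr₂ (mulMap α) =
      ((LinearMap.llcomp ℂ (TwistedGroupAlgebra α) (TwistedGroupAlgebra α)
        (TwistedGroupAlgebra α)).flip ∘ₗ mulMap α).flip ∘ₗ mulMap α := by
    refine (basis α).ext fun g => (basis α).ext fun h => (basis α).ext fun k => ?_
    have hc := congrArg (Units.val) (α.cocycle g h k)
    simp only [Units.val_mul] at hc
    simp [mulMap_basis, smul_smul, mul_assoc, hc, mul_comm]
  exact congrArg (fun T => T a b c) key

theorem one_mulMap (a : TwistedGroupAlgebra α) : mulMap α (basis α 1) a = a := by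
  have key : mulMap α (basis α 1) = LinearMap.id :=
    (basis α).ext fun g => by simp [mulMap_basis, α.one_left]
  rw [key]; rfl

theorem mulMap_one (a : TwistedGroupAlgebra α) : mulMap α a (basis α 1) = a := by
  have key : (mulMap α).flip (basis α 1) = LinearMap.id :=
    (basis α).ext fun g => by simp [mulMap_basis, α.one_right]
  exact congrArg (fun T => T a) key

noncomputable instance : Ring (TwistedGroupAlgebra α) :=
  { (inferInstance : AddCommGroup (TwistedGroupAlgebra α)) with
    mul := fun a b => mulMap α a b
    one := basis α 1
    mul_assoc := mulMap_assoc α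
    one_mul := one_mulMap α
    mul_one := mulMap_one α
    left_distrib := fun a b c => map_add (mulMap α a) b c
    right_distrib := fun a b c => LinearMap.map_add₂ (mulMap α) a b c
    zero_mul := fun a => LinearMap.map_zero₂ (mulMap α) a
    mul_zero := fun a => map_zero (mulMap α a) }

theorem mul_def (a b : TwistedGroupAlgebra α) : a * b = mulMap α a b := rfl

theorem one_def : (1 : TwistedGroupAlgebra α) = basis α 1 := rfl

noncomputable instance : Algebra ℂ (TwistedGroupAlgebra α) :=
  Algebra.ofModule (fun c a b => LinearMap.map_smul₂ (mulMap α) c a b)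
    (fun c a b => map_smul (mulMap α a) c b)

variable {α} {M : Type v} [AddCommGroup M] [Module ℂ M]

/-- The action of `ℂ^α[G]` on `M` with `ḡ` acting by `φ(g)`, for a projective representation
`φ` with cocycle `α`. -/
noncomputable def action (φ : G → M ≃ₗ[ℂ] M) (h1 : φ 1 = 1)
    (hα : ∀ (g h : G) (w : M), φ g (φ h w) = (α.toFun g h : ℂ) • φ (g * h) w) :
    TwistedGroupAlgebra α →ₐ[ℂ] Module.End ℂ M :=
  AlgHom.ofLinearMap ((basis α).constr ℂ fun g => ((φ g : M →ₗ[ℂ] M) : Module.End ℂ M))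
    (by rw [one_def, Module.Basis.constr_basis, h1]; rfl)
    (by
      intro a b
      have key : (mulMap α).compr₂
            ((basis α).constr ℂ fun g => ((φ g : M →ₗ[ℂ] M) : Module.End ℂ M)) =
          (LinearMap.mul ℂ (Module.End ℂ M)).compl₁₂
            ((basis α).constr ℂ fun g => ((φ g : M →ₗ[ℂ] M) : Module.End ℂ M))
            ((basis α).constr ℂ fun g => ((φ g : M →ₗ[ℂ] M) : Module.End ℂ M)) := by
        refine (basis α).ext fun g => (basis α).ext fun h => LinearMap.ext fun w => ?_
        simp [mulMap_basis, Module.Basis.constr_basis, hα]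
      exact congrArg (fun T => T a b) key)

theorem action_basis (φ : G → M ≃ₗ[ℂ] M) (h1 : φ 1 = 1)
    (hα : ∀ (g h : G) (w : M), φ g (φ h w) = (α.toFun g h : ℂ) • φ (g * h) w) (g : G) (w : M) :
    action φ h1 hα (basis α g) w = φ g w := by
  change ((basis α).constr ℂ fun g => ((φ g : M →ₗ[ℂ] M) : Module.End ℂ M)) (basis α g) w = _
  rw [Module.Basis.constr_basis]; rfl

end TwistedGroupAlgebra

/-- The actions of `ℂ^α[G]` and of `V^G` on a `σ`-twisted module commute. -/
theorem actionsCommute_action {V : Type u} [AddCommGroup V] [Module ℂ V] [VertexAlgebra V]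
    {G : Subgroup (Aut V)} [Finite G] {σ : G} {M : Type v} [AddCommGroup M] [Module ℂ M]
    {Y : TwistedModule V (σ : Aut V) M} {φ : G → M ≃ₗ[ℂ] M} (hφ : Y.IsIntertwiningFamily φ)
    {α : TwoCocycle G}
    (hα : ∀ (g h : G) (w : M), φ g (φ h w) = (α.toFun g h : ℂ) • φ (g * h) w) :
    ActionsCommute (TwistedGroupAlgebra.action φ hφ.1 hα) Y.restrictFixed := by
  intro a b n
  have key : (LinearMap.mul ℂ (Module.End ℂ M)).flip (Y.restrictFixed.mode b n) ∘ₗ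
        (TwistedGroupAlgebra.action φ hφ.1 hα).toLinearMap =
      LinearMap.mul ℂ (Module.End ℂ M) (Y.restrictFixed.mode b n) ∘ₗ
        (TwistedGroupAlgebra.action φ hφ.1 hα).toLinearMap := by
    refine (TwistedGroupAlgebra.basis α).ext fun g => LinearMap.ext fun w => ?_
    have h := hφ.2 g (b : V) n w
    rw [b.2 _ g.2] at h
    change TwistedGroupAlgebra.action φ hφ.1 hα _ (Y.mode (b : V) n w) =
      Y.mode (b : V) n (TwistedGroupAlgebra.action φ hφ.1 hα _ w)
    rw [TwistedGroupAlgebra.action_basis, TwistedGroupAlgebra.action_basis]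
    exact h
  exact congrArg (fun T => T a) key

/-! ### Irreducible modules of an algebra -/

set_option linter.checkUnivs false in
/-- A complete list without repetitions of the irreducible modules of the algebra `A` up to
isomorphism. -/
structure IrreducibleSystem (A : Type u) [Ring A] [Algebra ℂ A] where
  /-- The index set. -/
  Λ : Type v
  /-- The irreducible module with a given index. -/
  W : Λ → Type w
  [addCommGroup : ∀ i, AddCommGroup (W i)]
  [complexModule : ∀ i, Module ℂ (W i)]
  [algebraModule : ∀ i, Module A (W i)]
  [isScalarTower : ∀ i, IsScalarTower ℂ A (W i)]
  irreducible : ∀ i, IsSimpleModule A (W i)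
  irredundant : ∀ i j, Nonempty (W i ≃ₗ[A] W j) → i = j
  complete : ∀ (S : Type u) [AddCommGroup S] [Module A S], IsSimpleModule A S →
    ∃ i, Nonempty (S ≃ₗ[A] W i)

namespace IrreducibleSystem

attribute [instance] addCommGroup complexModule algebraModule isScalarTower

variable {A : Type u} [Ring A] [Algebra ℂ A] (𝓦 : IrreducibleSystem.{u, v, w} A)

noncomputable instance : DecidableEq 𝓦.Λ := Classical.decEq _

instance [Module.Finite ℂ A] (i : 𝓦.Λ) : FiniteDimensional ℂ (𝓦.W i) := by
  have := 𝓦.irreducible i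
  have : Module.Finite A (𝓦.W i) := inferInstance
  exact Module.Finite.trans A (𝓦.W i)

/-- Such a list exists. -/
theorem nonempty (A : Type u) [Ring A] [Algebra ℂ A] :
    Nonempty (IrreducibleSystem.{u, u, u} A) := by
  let X := {I : Submodule A A // IsSimpleModule A (A ⧸ I)}
  let s : Setoid X := ⟨fun I J => Nonempty ((A ⧸ I.1) ≃ₗ[A] (A ⧸ J.1)),
    ⟨fun I => ⟨LinearEquiv.refl _ _⟩, fun ⟨e⟩ => ⟨e.symm⟩, fun ⟨e⟩ ⟨f⟩ => ⟨e.trans f⟩⟩⟩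
  refine ⟨{ Λ := Quotient s, W := fun q => A ⧸ q.out.1, irreducible := fun q => q.out.2,
            irredundant := ?_, complete := ?_ }⟩
  · intro i j h
    rw [← Quotient.out_eq i, ← Quotient.out_eq j]
    exact Quotient.sound h
  · intro S _ _ hS
    obtain ⟨I, hI, ⟨e⟩⟩ := isSimpleModule_iff_quot_maximal.1 hS
    have hs : IsSimpleModule A (A ⧸ I) := (LinearEquiv.isSimpleModule_iff e).1 hS
    let x : X := ⟨I, hs⟩
    obtain ⟨f⟩ : Nonempty ((A ⧸ (Quotient.mk s x).out.1) ≃ₗ[A] (A ⧸ x.1)) :=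
      Quotient.exact (Quotient.out_eq (Quotient.mk s x))
    exact ⟨Quotient.mk s x, ⟨e.trans f.symm⟩⟩

end IrreducibleSystem

/-!
The proof rests on two consequences of the twisted Jacobi identity, both obtained by descending
induction from truncation.

*Associativity*: on finitely many vectors of a twisted module `M`, a product of modes agrees with a
linear combination of single modes (`mode_mode_mem_modeSpan`, applied to `M^ι`). So the span of the
`v_n w` is a submodule for every `w`; if `M` is irreducible then its dimension is countable, and
Schur's lemma holds: an operator commuting with the modes is a scalar, because an operator on a
space of countable dimension has nonempty spectrum. This gives the cocycle. With Jacobson's density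
theorem it also shows that combinations of modes realize every linear map on a finite-dimensional
subspace of `M` (`exists_modeOperators_comp_eq`). Averaging over `G`, combinations of modes of `V^G`
realize every `ℂ^α[G]`-homomorphism from a finite-dimensional `ℂ^α[G]`-submodule to `M`
(`exists_modeOperators_restrictFixed_comp_eq`). Hence a `V^G`-submodule of `Hom(W, M)` that contains
an injective map is everything (`eq_top_of_injective_mem`). For `W = W_λ` this is irreducibility of
`M_λ`; for `W = W_λ × W_μ`, `λ ≠ μ`, it says that the graph of an isomorphism `M_λ ≅ M_μ` cannot
exist.

*Commutativity*: if `∑ (v_j)_n w_j = 0` for all `n`, this persists when the `w_j` are replaced by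
their images under a mode, hence, by density, under any operator. As `V` is simple, the annihilator
of `M` in `V` is zero, and it follows that `∑ v_j ⊗ w_j = 0` (`sum_dual_smul_eq_zero`). Applied to a
relation `∑ c_g φ(g) = 0` of minimal length, this shows that the `φ(g)` are linearly independent, as
in Dedekind's lemma on characters. So `ℂ^α[G]` acts faithfully on `M`, and every `W_λ`, being
isomorphic to a left ideal of `ℂ^α[G]`, occurs in `M`.

The decomposition of `M` itself is that of a module over the semisimple algebra `ℂ^α[G]`;
semisimplicity is Maschke's theorem, by averaging a projection over the units `ḡ`.
-/

/-! ### Vertex algebras and finite-order automorphisms -/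

/-- If a finite sum and all its terms but the first lie in `K`, then so does the first term. -/
theorem Submodule.mem_of_finsum_mem {E : Type*} [AddCommGroup E] [Module ℂ E] (K : Submodule ℂ E)
    {f : ℕ → E} (hf : (Function.support f).Finite) (hs : ∑ᶠ i, f i ∈ K)
    (h : ∀ i, f (i + 1) ∈ K) : f 0 ∈ K := by
  have h1 : K.mkQ (∑ᶠ i, f i) = ∑ᶠ i, K.mkQ (f i) :=
    AddMonoidHom.map_finsum K.mkQ.toAddMonoidHom hf
  rw [finsum_eq_single (fun i => K.mkQ (f i)) 0] at h1
  · have h2 : K.mkQ (∑ᶠ i, f i) = 0 := by simpa using hs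
    rw [h2] at h1
    simpa using h1.symm
  · intro i hi
    obtain ⟨j, rfl⟩ := Nat.exists_eq_succ_of_ne_zero hi
    exact (Submodule.Quotient.mk_eq_zero K).2 (h j)

namespace VertexAlgebra

variable {V : Type u} [AddCommGroup V] [Module ℂ V] [VertexAlgebra V]

theorem aut_pow_apply (g : Aut V) (k : ℕ) (a : V) :
    ((g ^ (k + 1) : Aut V) : V ≃ₗ[ℂ] V) a =
      (g : V ≃ₗ[ℂ] V) (((g ^ k : Aut V) : V ≃ₗ[ℂ] V) a) := by
  rw [pow_succ']; rfl

/-- For an automorphism `g` of finite order `T`, a `g`-stable subspace is spanned by its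
intersections with the eigenspaces `V^r`, `0 ≤ r < T`. -/
theorem le_of_eigen_inf_le {g : Aut V} (hT : 0 < orderOf g) {p q : Submodule ℂ V}
    (hq : ∀ a ∈ q, (g : V ≃ₗ[ℂ] V) a ∈ q) (hp : ∀ r < orderOf g, eigen g r ⊓ q ≤ p) : q ≤ p := by
  set T := orderOf g with hTdef
  have hT0 : (T : ℂ) ≠ 0 := by exact_mod_cast hT.ne'
  set ζ : ℂ := Complex.exp (2 * Real.pi * Complex.I / T) with hζdef
  have hζ : IsPrimitiveRoot ζ T := Complex.isPrimitiveRoot_exp T hT.ne'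
  intro a haq
  have hpow : ∀ k : ℕ, ((g ^ k : Aut V) : V ≃ₗ[ℂ] V) a ∈ q := by
    intro k
    induction k with
    | zero => exact haq
    | succ k ih => rw [aut_pow_apply]; exact hq _ ih
  -- the projection of `T • a` to `V^r`
  let P : ℕ → V := fun r => ∑ k ∈ Finset.range T, ζ ^ (r * k) • ((g ^ k : Aut V) : V ≃ₗ[ℂ] V) a
  have hP : ∀ r < T, P r ∈ eigen g r := by
    intro r _
    have hz : Complex.exp (-2 * Real.pi * Complex.I * r / T) * ζ ^ r = 1 := by
      rw [hζdef, ← Complex.exp_nat_mul, ← Complex.exp_add, ← Complex.exp_zero]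
      congr 1
      field_simp
      ring
    rw [mem_eigen]
    have hs : ∀ b : ℕ → V, b T = b 0 →
        ∑ k ∈ Finset.range T, b (k + 1) = ∑ k ∈ Finset.range T, b k := by
      intro b hb
      have h1 := Finset.sum_range_succ b T
      rw [Finset.sum_range_succ', hb] at h1
      exact add_right_cancel h1
    have h2 := hs (fun k => ζ ^ (r * k) • ((g ^ k : Aut V) : V ≃ₗ[ℂ] V) a) (by
      simp only [hTdef, pow_orderOf_eq_one, pow_zero, mul_zero]
      rw [← hTdef, mul_comm, pow_mul, hζ.pow_eq_one, one_pow])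
    change (g : V ≃ₗ[ℂ] V) (P r) = _ • P r
    rw [← hTdef]
    conv_rhs => rw [show P r = _ from h2.symm]
    simp only [P, map_sum, map_smul, Finset.smul_sum, smul_smul]
    refine Finset.sum_congr rfl fun k _ => ?_
    rw [aut_pow_apply, mul_add, mul_one, pow_add, mul_comm (ζ ^ (r * k)), ← mul_assoc, hz, one_mul]
  have hsum : ∑ r ∈ Finset.range T, P r = (T : ℂ) • a := by
    simp only [P]
    rw [Finset.sum_comm, Finset.sum_eq_single 0]
    · simp [Nat.cast_smul_eq_nsmul]
    · intro k hk hk0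
      rw [← Finset.sum_smul]
      have h1 : ∑ r ∈ Finset.range T, ζ ^ (r * k) = 0 := by
        have h2 : (ζ ^ k - 1) * ∑ r ∈ Finset.range T, (ζ ^ k) ^ r = 0 := by
          rw [mul_geom_sum, ← pow_mul, mul_comm, pow_mul, hζ.pow_eq_one, one_pow, sub_self]
        have h3 : ζ ^ k - 1 ≠ 0 :=
          sub_ne_zero.2 (hζ.pow_ne_one_of_pos_of_lt hk0 (Finset.mem_range.1 hk))
        rw [← (mul_eq_zero.1 h2).resolve_left h3]
        exact Finset.sum_congr rfl fun r _ => by rw [← pow_mul, mul_comm]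
      rw [h1, zero_smul]
    · intro h
      exact absurd (Finset.mem_range.2 hT) h
  have h1 : (T : ℂ) • a ∈ p := by
    rw [← hsum]
    exact Submodule.sum_mem _ fun r hr =>
      hp r (Finset.mem_range.1 hr) ⟨hP r (Finset.mem_range.1 hr),
        Submodule.sum_mem _ fun k _ => Submodule.smul_mem _ _ (hpow k)⟩
  rwa [Submodule.smul_mem_iff _ hT0] at h1

theorem eq_top_of_eigen_le {g : Aut V} (hT : 0 < orderOf g) {p : Submodule ℂ V}
    (hp : ∀ r < orderOf g, eigen g r ≤ p) : p = ⊤ :=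
  top_le_iff.1 (le_of_eigen_inf_le hT (fun _ _ => trivial)
    fun r hr => inf_le_left.trans (hp r hr))

end VertexAlgebra

namespace TwistedModule

variable {V : Type u} [AddCommGroup V] [Module ℂ V] [VertexAlgebra V] {g : Aut V}
  {M : Type v} [AddCommGroup M] [Module ℂ M]

theorem support_jacobi_left (Y : TwistedModule V g M) (a b : V) (c : M) (l : ℤ) (m n : ℚ) :
    (Function.support fun i : ℕ => ((-1 : ℂ) ^ i * ((Ring.choose l i : ℤ) : ℂ)) •
        (Y.mode a (m + l - i) (Y.mode b (n + i) c) -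
          ((-1 : ℂ) ^ l) • Y.mode b (n + l - i) (Y.mode a (m + i) c))).Finite :=
  finite_support_left (Y.mode a) (Y.mode b) c (Y.truncation a c) (Y.truncation b c) _
    (fun _ => (-1 : ℂ) ^ l) _ _ _ _

/-! ### Associativity -/

/-- The span of all `a_n w`, for `a ∈ V` and `n ∈ ℚ`. -/
def modeSpan (Y : TwistedModule V g M) (w : M) : Submodule ℂ M :=
  Submodule.span ℂ (Set.range fun p : V × ℚ => Y.mode p.1 p.2 w)

theorem mode_mem_modeSpan (Y : TwistedModule V g M) (w : M) (a : V) (n : ℚ) :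
    Y.mode a n w ∈ Y.modeSpan w :=
  Submodule.subset_span ⟨(a, n), rfl⟩

theorem self_mem_modeSpan (Y : TwistedModule V g M) (w : M) : w ∈ Y.modeSpan w := by
  have h := Y.mode_mem_modeSpan w vac (-1)
  rwa [Y.vac_mode, if_pos rfl] at h

/-- A product `a_p b_n` applied to `w` is a combination of modes applied to `w`. If `a ∈ V^r`, take
the twisted Jacobi identity with `m` so large that `a_(m+i) w = 0` for all `i ≥ 0`, and with
`l = p - m`: modulo the span of the modes, `a_p b_n w` is a combination of the
`a_(p-i) b_(n+i) w`, `i ≥ 1`, and these are `0` for large `n`. -/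
theorem mode_mode_mem_modeSpan (Y : TwistedModule V g M) (hT : 0 < orderOf g) (w : M) (a b : V)
    (p n : ℚ) : Y.mode a p (Y.mode b n w) ∈ Y.modeSpan w := by
  suffices h : ∀ r < orderOf g, eigen g r ≤
      (Y.modeSpan w).comap ((LinearMap.applyₗ (Y.mode b n w)).comp
        ((LinearMap.proj p).comp Y.mode)) by
    have h1 : a ∈ (⊤ : Submodule ℂ V) := trivial
    rw [← eq_top_of_eigen_le hT h] at h1
    exact h1
  intro r hr a ha
  change Y.mode a p (Y.mode b n w) ∈ Y.modeSpan w
  obtain ⟨n₀, hn₀⟩ := Y.truncation b w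
  obtain ⟨m₀, hm₀⟩ := Y.truncation a w
  have key : ∀ (k : ℕ) (p n : ℚ), n₀ ≤ n + k → Y.mode a p (Y.mode b n w) ∈ Y.modeSpan w := by
    intro k
    induction k with
    | zero =>
      intro p n hn
      rw [hn₀ n (by simpa using hn), map_zero]
      exact zero_mem _
    | succ k ih =>
      intro p n hn
      by_cases hp : Y.mode a p = 0
      · rw [hp]; exact zero_mem _
      obtain ⟨s, hs⟩ := Y.mode_support r hr a ha p hp
      obtain ⟨t, ht⟩ := exists_int_gt (m₀ - (r : ℚ) / orderOf g)
      have hm : ∀ i : ℕ, Y.mode a ((r : ℚ) / orderOf g + t + i) w = 0 := fun i =>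
        hm₀ _ (by have : (0 : ℚ) ≤ i := i.cast_nonneg
                  linarith)
      have hJ := Y.jacobi r hr a ha b w (s - t) ((r : ℚ) / orderOf g + t) n ⟨t, rfl⟩
      have h0 := (Y.modeSpan w).mem_of_finsum_mem
        (Y.support_jacobi_left a b w (s - t) ((r : ℚ) / orderOf g + t) n)
        (by
          rw [hJ]
          exact finsum_induction (· ∈ Y.modeSpan w) (zero_mem _) (fun _ _ => add_mem)
            fun i => Submodule.smul_mem _ _ (Y.mode_mem_modeSpan w _ _))
        (fun i => by
          rw [hm, map_zero, smul_zero, sub_zero]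
          refine Submodule.smul_mem _ _ (ih _ _ ?_)
          push_cast at hn ⊢
          linarith)
      have h1 := hm 0
      simp only [Nat.cast_zero, add_zero] at h1
      simp only [pow_zero, Ring.choose_zero_right, Int.cast_one, mul_one, one_smul, Nat.cast_zero,
        add_zero, h1, map_zero, smul_zero, sub_zero] at h0
      rw [hs]
      convert h0 using 2
      push_cast
      ring_nf
  obtain ⟨k, hk⟩ := exists_nat_ge (n₀ - n)
  exact key k p n (by linarith)

theorem mode_mem_modeSpan_of_mem (Y : TwistedModule V g M) (hT : 0 < orderOf g) {w x : M}
    (hx : x ∈ Y.modeSpan w) (a : V) (p : ℚ) : Y.mode a p x ∈ Y.modeSpan w := by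
  have h : Y.modeSpan w ≤ (Y.modeSpan w).comap (Y.mode a p) := by
    refine Submodule.span_le.2 ?_
    rintro _ ⟨⟨b, n⟩, rfl⟩
    exact Y.mode_mode_mem_modeSpan hT w a b p n
  exact h hx

/-- The modes of `M^ι`, acting componentwise. -/
def piMode (Y : TwistedModule V g M) (ι : Type w) : V →ₗ[ℂ] ℚ → Module.End ℂ (ι → M) where
  toFun := fun a n => LinearMap.pi fun j => Y.mode a n ∘ₗ LinearMap.proj j
  map_add' := fun a b => by
    funext n
    refine LinearMap.ext fun w => funext fun j => ?_
    simp
  map_smul' := fun c a => by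
    funext n
    refine LinearMap.ext fun w => funext fun j => ?_
    simp

theorem piMode_apply (Y : TwistedModule V g M) (ι : Type w) (a : V) (n : ℚ) (y : ι → M) (j : ι) :
    Y.piMode ι a n y j = Y.mode a n (y j) := rfl

theorem piMode_truncation (Y : TwistedModule V g M) (ι : Type w) [Finite ι] (a : V) (y : ι → M) :
    ∃ N : ℚ, ∀ n : ℚ, N ≤ n → Y.piMode ι a n y = 0 := by
  choose k hk using fun j => Y.truncation a (y j)
  obtain ⟨N, hN⟩ := (Set.finite_range k).bddAbove
  exact ⟨N, fun n hn => funext fun j => hk j n ((hN ⟨j, rfl⟩).trans hn)⟩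

/-- The twisted module `M^ι`, for a finite index type `ι`. -/
def pi (Y : TwistedModule V g M) (ι : Type w) [Finite ι] : TwistedModule V g (ι → M) where
  mode := Y.piMode ι
  mode_support := fun r hr a ha n hn => Y.mode_support r hr a ha n fun h0 => hn <| by
    refine LinearMap.ext fun w => funext fun j => ?_
    rw [piMode_apply, h0]; rfl
  truncation := Y.piMode_truncation ι
  vac_mode := fun n => by
    refine LinearMap.ext fun w => funext fun j => ?_
    rw [piMode_apply, Y.vac_mode]
    split_ifs <;> rfl
  jacobi := fun r hr a ha b y l m n hm => by
    funext j
    have key : ∀ F : ℕ → ι → M, (Function.support F).Finite →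
        (∑ᶠ i, F i) j = ∑ᶠ i, F i j := fun F hF =>
      AddMonoidHom.map_finsum (Pi.evalAddMonoidHom (fun _ : ι => M) j) hF
    have hT := Y.piMode_truncation ι
    rw [key _ (finite_support_left (Y.piMode ι a) (Y.piMode ι b) y (hT a y) (hT b y) _
        (fun _ => (-1 : ℂ) ^ l) _ _ _ _),
      key _ (finite_support_right (Y.piMode ι) a b y _ l _)]
    exact Y.jacobi r hr a ha b (y j) l m n hm

/-! ### Commutativity, and the annihilator of a twisted module -/

/-- If `∑ (y_j)_n w_j = 0` for all `n`, then also `∑ (y_j)_n a_m w_j = 0` for all `n`. If `a ∈ V^r`,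
choose `l ≥ 0` with `a_(l+i) y_j = 0` for all `i ≥ 0`, so that the right-hand sides of the twisted
Jacobi identities vanish, and use descending induction on `m`. -/
theorem sum_mode_mode_eq_zero (Y : TwistedModule V g M) (hT : 0 < orderOf g) {ι : Type w}
    [Fintype ι] {y : ι → V} {w : ι → M} (h : ∀ n, ∑ j, Y.mode (y j) n (w j) = 0) (a : V)
    (m n : ℚ) : ∑ j, Y.mode (y j) n (Y.mode a m (w j)) = 0 := by
  suffices hs : ∀ r < orderOf g, eigen g r ≤
      LinearMap.ker (∑ j, (Y.mode (y j) n).comp ((LinearMap.applyₗ (w j)).comp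
        ((LinearMap.proj m).comp Y.mode))) by
    have h1 : a ∈ (⊤ : Submodule ℂ V) := trivial
    rw [← eq_top_of_eigen_le hT hs] at h1
    simpa using h1
  intro r hr a ha
  suffices hs : ∑ j, Y.mode (y j) n (Y.mode a m (w j)) = 0 by simpa using hs
  choose L₀ hL₀ using fun j => VertexAlgebra.truncation a (y j)
  obtain ⟨L₁, hL₁⟩ := (Set.finite_range L₀).bddAbove
  let L : ℕ := L₁.toNat
  have hL : ∀ (j : ι) (i : ℕ), VertexAlgebra.mode a ((L : ℤ) + i) (y j) = 0 := by
    intro j i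
    refine hL₀ j _ ((hL₁ ⟨j, rfl⟩).trans ?_)
    have := Int.self_le_toNat L₁
    omega
  choose M₀ hM₀ using fun j => Y.truncation a (w j)
  obtain ⟨M₁, hM₁⟩ := (Set.finite_range M₀).bddAbove
  have key : ∀ (k : ℕ) (m n : ℚ), M₁ ≤ m + k → ∑ j, Y.mode (y j) n (Y.mode a m (w j)) = 0 := by
    intro k
    induction k with
    | zero =>
      intro m n hm
      refine Finset.sum_eq_zero fun j _ => ?_
      rw [hM₀ j m ((hM₁ ⟨j, rfl⟩).trans (by simpa using hm)), map_zero]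
    | succ k ih =>
      intro m n hm
      by_cases hm0 : Y.mode a m = 0
      · simp [hm0]
      have hJ : ∀ j, _ := fun j => Y.jacobi r hr a ha (y j) (w j) L m (n - L)
        (Y.mode_support r hr a ha m hm0)
      simp only [hL, map_zero, Pi.zero_apply, LinearMap.zero_apply, smul_zero, finsum_zero] at hJ
      have hS := Finset.sum_eq_zero (s := Finset.univ) fun j _ => hJ j
      rw [← finsum_sum_comm _ _ fun j _ => Y.support_jacobi_left a (y j) (w j) L m (n - L)] at hS
      simp only [← Finset.smul_sum, Finset.sum_sub_distrib, ← map_sum, h, map_zero, zero_sub] at hS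
      rw [finsum_eq_single _ 0] at hS
      · have h1 : (-1 : ℂ) ^ (L : ℤ) ≠ 0 := zpow_ne_zero _ (by norm_num)
        simpa [h1] using hS
      · intro i hi
        obtain ⟨i, rfl⟩ := Nat.exists_eq_succ_of_ne_zero hi
        rw [ih _ _ (by push_cast at hm ⊢; linarith), smul_zero, neg_zero, smul_zero]
  obtain ⟨k, hk⟩ := exists_nat_ge (M₁ - m)
  exact key k m n (by linarith)

/-- If all modes of `b` or all modes of `a ∈ V^r` vanish on `M`, so do those of `a_l b`: the
left-hand side of the twisted Jacobi identity is `0`, and descending induction on `l` applies. -/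
theorem mode_mode_eq_zero_of_mem_eigen (Y : TwistedModule V g M) {r : ℕ} (hr : r < orderOf g)
    {a : V} (ha : a ∈ eigen g r) (b : V) (hab : Y.mode a = 0 ∨ Y.mode b = 0) (l : ℤ) :
    Y.mode (VertexAlgebra.mode a l b) = 0 := by
  obtain ⟨l₀, hl₀⟩ := VertexAlgebra.truncation a b
  have key : ∀ (k : ℕ) (l : ℤ), l₀ ≤ l + k → Y.mode (VertexAlgebra.mode a l b) = 0 := by
    intro k
    induction k with
    | zero =>
      intro l hl
      rw [hl₀ l (by simpa using hl), map_zero]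
    | succ k ih =>
      intro l hl
      funext q
      refine LinearMap.ext fun w => ?_
      have hJ := Y.jacobi r hr a ha b w l ((r : ℚ) / orderOf g) (q - (r : ℚ) / orderOf g)
        ⟨0, by simp⟩
      have h0 : ∀ i : ℕ, ((-1 : ℂ) ^ i * ((Ring.choose l i : ℤ) : ℂ)) •
          (Y.mode a ((r : ℚ) / orderOf g + l - i)
              (Y.mode b (q - (r : ℚ) / orderOf g + i) w) -
            ((-1 : ℂ) ^ l) • Y.mode b (q - (r : ℚ) / orderOf g + l - i)
              (Y.mode a ((r : ℚ) / orderOf g + i) w)) = 0 := by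
        intro i
        rcases hab with h | h <;> simp [h]
      simp only [h0, finsum_zero] at hJ
      rw [finsum_eq_single _ 0] at hJ
      · simpa using hJ.symm
      · intro i hi
        obtain ⟨i, rfl⟩ := Nat.exists_eq_succ_of_ne_zero hi
        rw [ih _ (by push_cast at hl ⊢; omega)]
        simp
  obtain ⟨k, hk⟩ : ∃ k : ℕ, l₀ ≤ l + k := ⟨(l₀ - l).toNat, by omega⟩
  exact key k l hk

/-- On each mode of index `n`, the automorphism `g` acts by a scalar, since only one eigenspace of
`g` has nonzero modes of index `n`. -/
theorem exists_mode_aut_eq_smul (Y : TwistedModule V g M) (hT : 0 < orderOf g) (n : ℚ) :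
    ∃ c : ℂ, ∀ a : V, Y.mode ((g : V ≃ₗ[ℂ] V) a) n = c • Y.mode a n := by
  by_cases hex : ∃ r < orderOf g, ∃ a ∈ eigen g r, Y.mode a n ≠ 0
  · obtain ⟨r, hr, a, ha, han⟩ := hex
    obtain ⟨k, hk⟩ := Y.mode_support r hr a ha n han
    refine ⟨Complex.exp (-2 * Real.pi * Complex.I * r / orderOf g), fun b => ?_⟩
    suffices h : ∀ s < orderOf g, eigen g s ≤
        LinearMap.ker (((LinearMap.proj n).comp Y.mode).comp ((g : V ≃ₗ[ℂ] V) : V →ₗ[ℂ] V) -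
          Complex.exp (-2 * Real.pi * Complex.I * r / orderOf g) •
            ((LinearMap.proj n).comp Y.mode)) by
      have h1 : b ∈ (⊤ : Submodule ℂ V) := trivial
      rw [← eq_top_of_eigen_le hT h] at h1
      simpa [sub_eq_zero] using h1
    intro s hs b hb
    suffices h : Y.mode ((g : V ≃ₗ[ℂ] V) b) n =
        Complex.exp (-2 * Real.pi * Complex.I * r / orderOf g) • Y.mode b n by
      simpa [sub_eq_zero] using h
    rw [(mem_eigen g s b).1 hb, map_smul, Pi.smul_apply]
    by_cases hbn : Y.mode b n = 0
    · rw [hbn, smul_zero, smul_zero]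
    · obtain ⟨k', hk'⟩ := Y.mode_support s hs b hb n hbn
      have hT' : (orderOf g : ℚ) ≠ 0 := by exact_mod_cast hT.ne'
      have h1 : (s : ℤ) + k' * orderOf g = r + k * orderOf g := by
        have h2 : (s : ℚ) / orderOf g + k' = (r : ℚ) / orderOf g + k := hk'.symm.trans hk
        field_simp at h2
        have h3 : (s : ℚ) + k' * orderOf g = r + k * orderOf g := by linarith
        exact_mod_cast h3
      have h2 : s = r := by
        have h3 := congrArg (· % (orderOf g : ℤ)) h1
        simp only [Int.add_mul_emod_self_right] at h3
        rw [Int.emod_eq_of_lt (by omega) (by omega), Int.emod_eq_of_lt (by omega) (by omega)] at h3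
        exact_mod_cast h3
      rw [h2]
  · push Not at hex
    refine ⟨0, fun b => ?_⟩
    have h1 : ∀ b, Y.mode b n = 0 := by
      intro b
      have h2 : b ∈ (⊤ : Submodule ℂ V) := trivial
      rw [← eq_top_of_eigen_le hT (p := LinearMap.ker ((LinearMap.proj n).comp Y.mode))
        fun s hs b hb => hex s hs b hb] at h2
      exact h2
    rw [h1, zero_smul]

/-- The annihilator of a nonzero twisted module of a simple vertex algebra is zero: it is an ideal
that does not contain the vacuum. -/
theorem eq_zero_of_mode_eq_zero (Y : TwistedModule V g M) (hT : 0 < orderOf g)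
    (hV : VertexAlgebra.IsSimple V) [Nontrivial M] {a : V} (ha : Y.mode a = 0) : a = 0 := by
  let I : Submodule ℂ V := LinearMap.ker Y.mode
  have hI : IsIdeal V I := by
    intro b n c hc
    change Y.mode c = 0 at hc
    refine ⟨?_, ?_⟩
    · have h : (⊤ : Submodule ℂ V) ≤ I.comap ((LinearMap.applyₗ c).comp
          ((LinearMap.proj n).comp VertexAlgebra.mode)) :=
        (eq_top_of_eigen_le hT fun r hr b hb =>
          Y.mode_mode_eq_zero_of_mem_eigen hr hb c (Or.inr hc) n).ge
      exact h (trivial : b ∈ ⊤)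
    · -- the annihilator is spanned by its intersections with the eigenspaces of `g`, because the
      -- automorphism `g` acts on the modes of each index by a scalar
      have h : I ≤ I.comap ((LinearMap.applyₗ b).comp
          ((LinearMap.proj n).comp VertexAlgebra.mode)) := by
        refine le_of_eigen_inf_le hT (fun d hd => ?_) fun r hr d hd =>
          Y.mode_mode_eq_zero_of_mem_eigen hr hd.1 b (Or.inl hd.2) n
        refine funext fun q => ?_
        obtain ⟨s, hs⟩ := Y.exists_mode_aut_eq_smul hT q
        rw [hs, show Y.mode d = 0 from hd, Pi.zero_apply, smul_zero]
      exact h hc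
  rcases hV.2 I hI with h | h
  · have h1 : a ∈ I := ha
    rwa [h, Submodule.mem_bot] at h1
  · exfalso
    have h1 : (vac : V) ∈ I := h ▸ trivial
    obtain ⟨w, hw⟩ := exists_ne (0 : M)
    have h2 := Y.vac_mode (-1)
    rw [show Y.mode (vac : V) = 0 from h1] at h2
    exact hw (congrArg (fun f : Module.End ℂ M => f w) h2).symm

end TwistedModule

/-! ### Schur's lemma in countable dimension, and density -/

open Polynomial in
/-- An endomorphism `f` of a nonzero complex space of countable dimension has nonempty spectrum.
Otherwise, for a vector `w ≠ 0`, the uncountably many vectors `(f - c)⁻¹ w` are linearly dependent;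
clearing denominators gives a polynomial `P ≠ 0` with `P(f) w = 0`, but `P(f)` is a product of
invertible operators. -/
theorem Module.End.exists_not_isUnit_sub_algebraMap {M : Type v} [AddCommGroup M] [Module ℂ M]
    [Nontrivial M] (hM : Module.rank ℂ M ≤ Cardinal.aleph0) (f : Module.End ℂ M) :
    ∃ c : ℂ, ¬ IsUnit (f - algebraMap ℂ (Module.End ℂ M) c) := by
  classical
  by_contra! hf
  obtain ⟨w, hw⟩ := exists_ne (0 : M)
  have hinv : ∀ c : ℂ, ∃ z : M, (f - algebraMap ℂ (Module.End ℂ M) c) z = w := fun c =>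
    ((Module.End.isUnit_iff _).1 (hf c)).2 w
  choose z hz using hinv
  have hli : LinearIndependent ℂ z := by
    refine linearIndependent_iff'.2 fun s m hm c hc => ?_
    let P : ℂ[X] := ∑ j ∈ s, C (m j) * ∏ k ∈ s.erase j, (X - C k)
    have haux : ∀ j ∈ s, aeval f (C (m j) * ∏ k ∈ s.erase j, (X - C k)) w =
        m j • aeval f (∏ k ∈ s, (X - C k)) (z j) := by
      intro j hj
      rw [← Finset.prod_erase_mul s _ hj, ← Polynomial.smul_eq_C_mul, map_smul, map_mul,
        Module.End.mul_apply, LinearMap.smul_apply]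
      congr 2
      rw [← hz j]
      simp
    have hPw : aeval f P w = 0 := by
      rw [map_sum, LinearMap.sum_apply, Finset.sum_congr rfl haux]
      simp_rw [← map_smul]
      rw [← map_sum, hm, map_zero]
    have hP : P = 0 := by
      by_contra hP0
      have hu : IsUnit (aeval f P) := by
        rw [(IsAlgClosed.splits P).eq_prod_roots, map_mul, aeval_C]
        refine IsUnit.mul ?_ ?_
        · exact (IsUnit.mk0 _ (leadingCoeff_ne_zero.2 hP0)).map (algebraMap ℂ (Module.End ℂ M))
        · by_contra hn
          obtain ⟨k, hk, -⟩ := spectrum.exists_mem_of_not_isUnit_aeval_prod hn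
          rw [spectrum.mem_iff] at hk
          have h1 := (hf k).neg
          rw [neg_sub] at h1
          exact hk h1
      exact hw (((Module.End.isUnit_iff _).1 hu).1 (hPw.trans (map_zero _).symm))
    have h1 : eval c P = m c * ∏ k ∈ s.erase c, (c - k) := by
      simp only [P, eval_finsetSum, eval_mul, eval_C, eval_prod, eval_sub, eval_X]
      refine Finset.sum_eq_single_of_mem c hc fun j _ hjc => ?_
      rw [Finset.prod_eq_zero (Finset.mem_erase.2 ⟨hjc.symm, hc⟩) (sub_self c), mul_zero]
    rw [hP, eval_zero] at h1
    refine (mul_eq_zero.1 h1.symm).resolve_right (Finset.prod_ne_zero_iff.2 fun k hk => ?_)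
    exact sub_ne_zero.2 (Finset.ne_of_mem_erase hk).symm
  have h1 := hli.cardinal_lift_le_rank
  have h2 : Cardinal.lift.{v} (Cardinal.mk ℂ) ≤ Cardinal.aleph0 :=
    h1.trans (by simpa using hM)
  rw [Cardinal.mk_complex, Cardinal.lift_continuum] at h2
  exact absurd h2 (not_le.2 Cardinal.aleph0_lt_continuum)

namespace TwistedModule

variable {V : Type u} [AddCommGroup V] [Module ℂ V] [VertexAlgebra V] {g : Aut V}
  {M : Type v} [AddCommGroup M] [Module ℂ M]

theorem modeSpan_eq_top {Y : TwistedModule V g M} (hT : 0 < orderOf g) (hY : Y.IsIrreducible)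
    {w : M} (hw : w ≠ 0) : Y.modeSpan w = ⊤ := by
  refine (hY.2 _ fun a n x hx => Y.mode_mem_modeSpan_of_mem hT hx a n).resolve_left fun h => ?_
  have h1 := Y.self_mem_modeSpan w
  rw [h, Submodule.mem_bot] at h1
  exact hw h1

theorem rank_le_aleph0 {Y : TwistedModule V g M} (hT : 0 < orderOf g) (hY : Y.IsIrreducible)
    (hV : Module.rank ℂ V ≤ Cardinal.aleph0) : Module.rank ℂ M ≤ Cardinal.aleph0 := by
  have := hY.1
  obtain ⟨w, hw⟩ := exists_ne (0 : M)
  let b := Module.Basis.ofVectorSpace ℂ V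
  have hb : Countable (Module.Basis.ofVectorSpaceIndex ℂ V) := by
    rw [← Cardinal.mk_le_aleph0_iff]
    exact b.mk_eq_rank''.trans_le hV
  let S : Set M := Set.range fun p : Module.Basis.ofVectorSpaceIndex ℂ V × ℚ => Y.mode (b p.1) p.2 w
  have hS : Submodule.span ℂ S = ⊤ := by
    rw [← modeSpan_eq_top hT hY hw]
    refine le_antisymm (Submodule.span_le.2 ?_) (Submodule.span_le.2 ?_)
    · rintro _ ⟨p, rfl⟩
      exact Y.mode_mem_modeSpan w _ _
    · rintro _ ⟨⟨a, n⟩, rfl⟩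
      have h : (⊤ : Submodule ℂ V) ≤ (Submodule.span ℂ S).comap ((LinearMap.applyₗ w).comp
          ((LinearMap.proj n).comp Y.mode)) := by
        rw [← b.span_eq]
        refine Submodule.span_le.2 ?_
        rintro _ ⟨i, rfl⟩
        exact Submodule.subset_span ⟨(i, n), rfl⟩
      exact h (trivial : a ∈ ⊤)
  rw [← rank_top, ← hS]
  exact (rank_span_le S).trans (Cardinal.le_aleph0_iff_set_countable.2 (Set.countable_range _))

/-- Schur's lemma: an endomorphism of an irreducible twisted module is a scalar. -/
theorem exists_eq_smul_of_commute {Y : TwistedModule V g M} (hT : 0 < orderOf g)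
    (hY : Y.IsIrreducible) (hV : Module.rank ℂ V ≤ Cardinal.aleph0) {f : Module.End ℂ M}
    (hf : ∀ (a : V) (n : ℚ) (w : M), f (Y.mode a n w) = Y.mode a n (f w)) :
    ∃ c : ℂ, ∀ w, f w = c • w := by
  have := hY.1
  obtain ⟨c, hc⟩ := Module.End.exists_not_isUnit_sub_algebraMap (rank_le_aleph0 hT hY hV) f
  refine ⟨c, ?_⟩
  set d := f - algebraMap ℂ (Module.End ℂ M) c with hd
  have hdw : ∀ w, d w = f w - c • w := fun w => by simp [hd, Module.algebraMap_end_apply]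
  have hcomm : ∀ (a : V) (n : ℚ) (w : M), d (Y.mode a n w) = Y.mode a n (d w) := by
    intro a n w
    rw [hdw, hdw, hf, map_sub, map_smul]
  suffices h : d = 0 by
    intro w
    have h1 := hdw w
    rw [h, LinearMap.zero_apply] at h1
    exact sub_eq_zero.1 h1.symm
  by_contra hd0
  refine hc ((Module.End.isUnit_iff _).2 ⟨?_, ?_⟩)
  · rw [← LinearMap.ker_eq_bot]
    refine (hY.2 (LinearMap.ker d) fun a n w hw => ?_).resolve_right fun h =>
      hd0 (LinearMap.ker_eq_top.1 h)
    rw [LinearMap.mem_ker] at hw ⊢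
    rw [hcomm, hw, map_zero]
  · rw [← LinearMap.range_eq_top]
    refine (hY.2 (LinearMap.range d) fun a n w hw => ?_).resolve_left fun h =>
      hd0 (LinearMap.range_eq_bot.1 h)
    obtain ⟨y, rfl⟩ := hw
    exact ⟨Y.mode a n y, hcomm a n y⟩

/-- The space of operators on `M` spanned by all modes. -/
def modeOperators (Y : TwistedModule V g M) : Submodule ℂ (Module.End ℂ M) :=
  Submodule.span ℂ (Set.range fun p : V × ℚ => Y.mode p.1 p.2)

theorem mode_mem_modeOperators (Y : TwistedModule V g M) (a : V) (n : ℚ) :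
    Y.mode a n ∈ Y.modeOperators :=
  Submodule.subset_span ⟨(a, n), rfl⟩

/-- The associative algebra generated by all modes. -/
def modeAlgebra (Y : TwistedModule V g M) : Subalgebra ℂ (Module.End ℂ M) :=
  Algebra.adjoin ℂ (Set.range fun p : V × ℚ => Y.mode p.1 p.2)

theorem mode_mem_modeAlgebra (Y : TwistedModule V g M) (a : V) (n : ℚ) :
    Y.mode a n ∈ Y.modeAlgebra :=
  Algebra.subset_adjoin ⟨(a, n), rfl⟩

/-- On finitely many vectors, each operator in the algebra generated by the modes agrees with a
linear combination of modes. -/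
theorem exists_modeOperators_eq (Y : TwistedModule V g M) (hT : 0 < orderOf g) {ι : Type w}
    [Finite ι] (y : ι → M) {a : Module.End ℂ M} (ha : a ∈ Y.modeAlgebra) :
    ∃ b ∈ Y.modeOperators, ∀ j, b (y j) = a (y j) := by
  have h1 : ∀ x ∈ (Y.pi ι).modeSpan y, (fun j => a (x j)) ∈ (Y.pi ι).modeSpan y := by
    induction ha using Algebra.adjoin_induction with
    | mem a ha =>
      obtain ⟨⟨b, n⟩, rfl⟩ := ha
      exact fun x hx => (Y.pi ι).mode_mem_modeSpan_of_mem hT hx b n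
    | algebraMap c => exact fun x hx => Submodule.smul_mem _ c hx
    | add a b _ _ ha hb => exact fun x hx => add_mem (ha x hx) (hb x hx)
    | mul a b _ _ ha hb => exact fun x hx => ha _ (hb x hx)
  have h2 : (Y.pi ι).modeSpan y ≤
      Y.modeOperators.map (LinearMap.pi fun j => LinearMap.applyₗ (y j)) := by
    refine Submodule.span_le.2 ?_
    rintro _ ⟨⟨b, n⟩, rfl⟩
    exact ⟨Y.mode b n, Y.mode_mem_modeOperators b n, rfl⟩
  obtain ⟨b, hb, hby⟩ := h2 (h1 y ((Y.pi ι).self_mem_modeSpan y))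
  exact ⟨b, hb, fun j => congrFun hby j⟩

theorem isSimpleModule_modeAlgebra {Y : TwistedModule V g M} (hY : Y.IsIrreducible) :
    IsSimpleModule Y.modeAlgebra M := by
  have := hY.1
  rw [isSimpleModule_iff]
  refine { exists_pair_ne := ⟨⊥, ⊤, bot_ne_top⟩, eq_bot_or_eq_top := fun N => ?_ }
  have h := hY.2 (N.restrictScalars ℂ) fun a n w hw =>
    N.smul_mem (⟨Y.mode a n, Y.mode_mem_modeAlgebra a n⟩ : Y.modeAlgebra) hw
  simpa using h

/-- Density: if `f : W → M` is injective, with `W` finite-dimensional and `M` irreducible, then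
every linear map `W → M` is the composition of `f` with a linear combination of modes. -/
theorem exists_modeOperators_comp_eq {Y : TwistedModule V g M} (hT : 0 < orderOf g)
    (hY : Y.IsIrreducible) (hV : Module.rank ℂ V ≤ Cardinal.aleph0) {W : Type w} [AddCommGroup W]
    [Module ℂ W] [FiniteDimensional ℂ W] (f f' : W →ₗ[ℂ] M) (hf : Function.Injective f) :
    ∃ b ∈ Y.modeOperators, ∀ y, b (f y) = f' y := by
  classical
  have := isSimpleModule_modeAlgebra hY
  obtain ⟨h, hh⟩ := LinearMap.exists_leftInverse_of_injective f (LinearMap.ker_eq_bot.2 hf)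
  let T : Module.End (Module.End Y.modeAlgebra M) M :=
    { toFun := f' ∘ₗ h
      map_add' := map_add _
      map_smul' := fun e m => by
        obtain ⟨c, hc⟩ := exists_eq_smul_of_commute hT hY hV
          (f := e.restrictScalars ℂ) fun a n w =>
            e.map_smul (⟨Y.mode a n, Y.mode_mem_modeAlgebra a n⟩ : Y.modeAlgebra) w
        change (f' ∘ₗ h) (e m) = e ((f' ∘ₗ h) m)
        have hc' : ∀ w, e w = c • w := hc
        rw [hc', hc', map_smul] }
  let B := Module.Basis.ofVectorSpace ℂ W
  obtain ⟨a, ha⟩ := jacobson_density (R := Y.modeAlgebra) T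
    (Finset.univ.image fun i => f (B i))
  obtain ⟨b, hb, hbB⟩ := Y.exists_modeOperators_eq hT (fun i => f (B i)) a.2
  refine ⟨b, hb, fun y => ?_⟩
  have h1 : b ∘ₗ f = f' := B.ext fun i => by
    have h2 : f' (h (f (B i))) = (a : Module.End ℂ M) (f (B i)) :=
      ha _ (Finset.mem_image_of_mem _ (Finset.mem_univ i))
    have h3 : h (f (B i)) = B i := LinearMap.congr_fun hh (B i)
    rw [LinearMap.comp_apply, hbB, ← h2, h3]
  exact LinearMap.congr_fun h1 y

/-- If `∑ (y_j)_n w_j = 0` for all `n`, then `∑ y_j ⊗ w_j = 0` (stated after applying linear forms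
to the `y_j`), for an irreducible twisted module of a simple vertex algebra. By density and
commutativity, the hypothesis persists when the `w_j` are replaced by their images under any linear
operator; for the rank one operators `λ(·) w`, it says that `∑ λ(w_j) y_j` annihilates `M`. -/
theorem sum_dual_smul_eq_zero {Y : TwistedModule V g M} (hT : 0 < orderOf g)
    (hY : Y.IsIrreducible) (hV : Module.rank ℂ V ≤ Cardinal.aleph0)
    (hs : VertexAlgebra.IsSimple V) {ι : Type w} [Fintype ι] {y : ι → V} {w : ι → M}
    (h : ∀ n, ∑ j, Y.mode (y j) n (w j) = 0) (ℓ : Module.Dual ℂ V) :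
    ∑ j, ℓ (y j) • w j = 0 := by
  have := hY.1
  have hop : ∀ b ∈ Y.modeOperators, ∀ n, ∑ j, Y.mode (y j) n (b (w j)) = 0 := by
    intro b hb n
    have h1 : Y.modeOperators ≤ LinearMap.ker
        (∑ j, (Y.mode (y j) n).comp (LinearMap.applyₗ (w j)) : Module.End ℂ M →ₗ[ℂ] M) := by
      refine Submodule.span_le.2 ?_
      rintro _ ⟨⟨a, m⟩, rfl⟩
      simpa using Y.sum_mode_mode_eq_zero hT h a m n
    simpa using h1 hb
  let X : Submodule ℂ M := Submodule.span ℂ (Set.range w)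
  have : FiniteDimensional ℂ X := FiniteDimensional.span_of_finite ℂ (Set.finite_range w)
  have hw : ∀ j, w j ∈ X := fun j => Submodule.subset_span ⟨j, rfl⟩
  have key : ∀ l : Module.Dual ℂ M, ∑ j, l (w j) • y j = 0 := by
    intro l
    refine Y.eq_zero_of_mode_eq_zero hT hs (funext fun n => LinearMap.ext fun m => ?_)
    obtain ⟨b, hb, hbX⟩ := exists_modeOperators_comp_eq hT hY hV X.subtype
      ((l.smulRight m).comp X.subtype) X.injective_subtype
    have h1 := hop b hb n
    have h2 : ∀ j, b (w j) = l (w j) • m := fun j => hbX ⟨w j, hw j⟩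
    simp only [h2, map_smul] at h1
    simpa [map_sum] using h1
  refine (Module.forall_dual_apply_eq_zero_iff ℂ _).1 fun l => ?_
  have h1 := congrArg ℓ (key l)
  simpa [map_sum, mul_comm] using h1

end TwistedModule

/-! ### Twisted group algebras are semisimple -/

namespace TwistedGroupAlgebra

variable {G : Type u} [Group G] (α : TwoCocycle G)

theorem basis_mul_basis (g h : G) :
    basis α g * basis α h = (α.toFun g h : ℂ) • basis α (g * h) := mulMap_basis α g h

theorem exists_unit (g : G) : ∃ a : (TwistedGroupAlgebra α)ˣ, (a : TwistedGroupAlgebra α) =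
    basis α g := by
  have hl : (((α.toFun g⁻¹ g)⁻¹ : ℂˣ) : ℂ) • basis α g⁻¹ * basis α g = 1 := by
    rw [smul_mul_assoc, basis_mul_basis, smul_smul, Units.inv_mul, one_smul, inv_mul_cancel,
      one_def]
  have hr : basis α g * (((α.toFun g g⁻¹)⁻¹ : ℂˣ) : ℂ) • basis α g⁻¹ = 1 := by
    rw [mul_smul_comm, basis_mul_basis, smul_smul, Units.inv_mul, one_smul, mul_inv_cancel,
      one_def]
  have h := left_inv_eq_right_inv hl hr
  exact ⟨⟨basis α g, _, hr, h ▸ hl⟩, rfl⟩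

/-- The basis element `ḡ` as a unit. -/
noncomputable def unit (g : G) : (TwistedGroupAlgebra α)ˣ := (exists_unit α g).choose

theorem coe_unit (g : G) : (unit α g : TwistedGroupAlgebra α) = basis α g :=
  (exists_unit α g).choose_spec

theorem unit_mul_unit (g h : G) :
    ((unit α g * unit α h : (TwistedGroupAlgebra α)ˣ) : TwistedGroupAlgebra α) =
      (α.toFun g h : ℂ) • (unit α (g * h) : TwistedGroupAlgebra α) := by
  rw [Units.val_mul, coe_unit, coe_unit, coe_unit, basis_mul_basis]

/-- `ḡ⁻¹ = α(h, g)⁻¹ ((hg)‾)⁻¹ h̄`. -/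
theorem unit_inv_eq (g h : G) : ((unit α g)⁻¹ : (TwistedGroupAlgebra α)ˣ) =
    (((α.toFun h g)⁻¹ : ℂˣ) : ℂ) •
      ((((unit α (h * g))⁻¹ * unit α h : (TwistedGroupAlgebra α)ˣ)) : TwistedGroupAlgebra α) := by
  rw [← (unit α g).mul_left_inj, Units.inv_mul, smul_mul_assoc, Units.val_mul, mul_assoc,
    ← Units.val_mul, unit_mul_unit, mul_smul_comm, smul_smul, Units.inv_mul, one_smul,
    Units.inv_mul]

variable {N : Type v} [AddCommGroup N] [Module ℂ N] [Module (TwistedGroupAlgebra α) N]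
  [IsScalarTower ℂ (TwistedGroupAlgebra α) N]

variable {α} in
theorem map_smul_of_map_basis_smul {N' : Type w} [AddCommGroup N'] [Module ℂ N']
    [Module (TwistedGroupAlgebra α) N'] [IsScalarTower ℂ (TwistedGroupAlgebra α) N']
    (f : N →ₗ[ℂ] N') (hf : ∀ g y, f (basis α g • y) = basis α g • f y)
    (a : TwistedGroupAlgebra α) (y : N) : f (a • y) = a • f y := by
  have h1 : a ∈ Submodule.span ℂ (Set.range (basis α)) := by rw [(basis α).span_eq]; trivial
  induction h1 using Submodule.span_induction with
  | mem a ha => obtain ⟨g, rfl⟩ := ha; exact hf g y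
  | zero => simp
  | add a b _ _ ha hb => rw [add_smul, add_smul, map_add, ha, hb]
  | smul c a _ ha => rw [smul_assoc, map_smul, ha, smul_assoc]

/-- Maschke's theorem: averaging the conjugates of a linear projection by the units `ḡ` gives an
equivariant projection, because the values of the cocycle cancel in the conjugates. -/
theorem isSemisimpleModule [Finite G] : IsSemisimpleModule (TwistedGroupAlgebra α) N := by
  have := Fintype.ofFinite G
  rw [isSemisimpleModule_iff]
  refine ⟨fun p => ?_⟩
  obtain ⟨π, hπ⟩ := LinearMap.exists_leftInverse_of_injective (p.subtype.restrictScalars ℂ)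
    (LinearMap.ker_eq_bot.2 p.injective_subtype)
  have hπ' : ∀ y : p, π (y : N) = y := LinearMap.congr_fun hπ
  let P : N →ₗ[ℂ] p := (Fintype.card G : ℂ)⁻¹ • ∑ g : G,
    (Algebra.lsmul ℂ ℂ p (unit α g : TwistedGroupAlgebra α)) ∘ₗ π ∘ₗ
      (Algebra.lsmul ℂ ℂ N (((unit α g)⁻¹ : (TwistedGroupAlgebra α)ˣ) : TwistedGroupAlgebra α))
  have hP : ∀ y, P y = (Fintype.card G : ℂ)⁻¹ • ∑ g : G, (unit α g : TwistedGroupAlgebra α) •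
      π ((((unit α g)⁻¹ : (TwistedGroupAlgebra α)ˣ) : TwistedGroupAlgebra α) • y) := by
    intro y
    simp [P]
  have hcard : (Fintype.card G : ℂ) ≠ 0 := by exact_mod_cast Fintype.card_ne_zero
  have hid : ∀ y : p, P (y : N) = y := by
    intro y
    rw [hP]
    have h1 : ∀ g : G, (unit α g : TwistedGroupAlgebra α) •
        π ((((unit α g)⁻¹ : (TwistedGroupAlgebra α)ˣ) : TwistedGroupAlgebra α) • (y : N)) = y := by
      intro g
      rw [← Submodule.coe_smul, hπ', smul_smul, Units.mul_inv, one_smul]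
    rw [Finset.sum_congr rfl fun g _ => h1 g, Finset.sum_const, Finset.card_univ,
      ← Nat.cast_smul_eq_nsmul ℂ, smul_smul, inv_mul_cancel₀ hcard, one_smul]
  have heq : ∀ h y, P (basis α h • y) = basis α h • P y := by
    intro h y
    have hc : ∀ (c : ℂ) (a : TwistedGroupAlgebra α) (z : p), a • c • z = c • a • z :=
      fun c a z => smul_comm a c z
    rw [hP, hP, hc, Finset.smul_sum (r := basis α h)]
    congr 1
    symm
    refine Fintype.sum_equiv (Equiv.mulLeft h) _ _ fun g => ?_
    simp only [Equiv.coe_mulLeft]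
    rw [unit_inv_eq α g h, smul_assoc, map_smul, hc, hc, smul_smul (basis α h),
      ← coe_unit, ← Units.val_mul, unit_mul_unit, smul_assoc, smul_smul, Units.inv_mul, one_smul,
      Units.val_mul, mul_smul]
  let P' : N →ₗ[TwistedGroupAlgebra α] p :=
    { toFun := P
      map_add' := map_add P
      map_smul' := map_smul_of_map_basis_smul P heq }
  exact ⟨LinearMap.ker P', LinearMap.isCompl_of_proj hid⟩

end TwistedGroupAlgebra

/-! ### Averaging modes over the group -/

namespace TwistedModule

variable {V : Type u} [AddCommGroup V] [Module ℂ V] [VertexAlgebra V]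
  {M : Type v} [AddCommGroup M] [Module ℂ M] {G : Subgroup (Aut V)} [Finite G] {σ : G}

/-- Density for `V^G`: if `f : W → M` is an injective homomorphism of `ℂ^α[G]`-modules, with `W`
finite-dimensional, then every homomorphism `f' : W → M` is the composition of `f` with a linear
combination of modes of elements of `V^G`. This is the average over `G` of a combination of modes
of elements of `V` with that property. -/
theorem exists_modeOperators_restrictFixed_comp_eq {Y : TwistedModule V (σ : Aut V) M}
    (hY : Y.IsIrreducible) (hV : Module.rank ℂ V ≤ Cardinal.aleph0) {φ : G → M ≃ₗ[ℂ] M}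
    (hφ : Y.IsIntertwiningFamily φ) {α : TwoCocycle G}
    (hα : ∀ (g h : G) (w : M), φ g (φ h w) = (α.toFun g h : ℂ) • φ (g * h) w)
    {W : Type w} [AddCommGroup W] [Module ℂ W] [Module (TwistedGroupAlgebra α) W]
    [FiniteDimensional ℂ W]
    (f f' : multiplicitySpace (TwistedGroupAlgebra.action φ hφ.1 hα) W)
    (hf : Function.Injective f.1) :
    ∃ b ∈ Y.restrictFixed.modeOperators, ∀ y, b (f.1 y) = f'.1 y := by
  have := Fintype.ofFinite G
  obtain ⟨b, hb, hbf⟩ := exists_modeOperators_comp_eq (orderOf_coe_pos σ) hY hV f.1 f'.1 hf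
  have hcard : (Fintype.card G : ℂ) ≠ 0 := by exact_mod_cast Fintype.card_ne_zero
  -- the average over `G`
  let P : Module.End ℂ M →ₗ[ℂ] Module.End ℂ M := (Fintype.card G : ℂ)⁻¹ •
    ∑ g : G, ((φ g).conj : Module.End ℂ M →ₗ[ℂ] Module.End ℂ M)
  have hP : ∀ c w, P c w = (Fintype.card G : ℂ)⁻¹ • ∑ g : G, φ g (c ((φ g).symm w)) := by
    intro c w
    simp [P, LinearEquiv.conj_apply]
  have hmem : Y.modeOperators ≤ Y.restrictFixed.modeOperators.comap P := by
    refine Submodule.span_le.2 ?_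
    rintro _ ⟨⟨a, n⟩, rfl⟩
    have hfix : ∑ g : G, ((g : Aut V) : V ≃ₗ[ℂ] V) a ∈ fixedPoints G := by
      intro h hh
      rw [map_sum]
      exact Fintype.sum_equiv (Equiv.mulLeft (⟨h, hh⟩ : G)) _ _ fun g => rfl
    have h1 : P (Y.mode a n) = (Fintype.card G : ℂ)⁻¹ • Y.restrictFixed.mode ⟨_, hfix⟩ n := by
      refine LinearMap.ext fun w => ?_
      rw [hP, LinearMap.smul_apply]
      congr 1
      change _ = Y.mode (∑ g : G, ((g : Aut V) : V ≃ₗ[ℂ] V) a) n w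
      rw [map_sum, Finset.sum_apply, LinearMap.sum_apply]
      refine Finset.sum_congr rfl fun g _ => ?_
      rw [hφ.2, LinearEquiv.apply_symm_apply]
    change P (Y.mode a n) ∈ Y.restrictFixed.modeOperators
    rw [h1]
    exact Submodule.smul_mem _ _ (mode_mem_modeOperators _ _ _)
  refine ⟨P b, hmem hb, fun y => ?_⟩
  rw [hP]
  have h1 : ∀ g : G, φ g (b ((φ g).symm (f.1 y))) = f'.1 y := by
    intro g
    have hbas : ∀ (e : multiplicitySpace (TwistedGroupAlgebra.action φ hφ.1 hα) W) (z : W),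
        e.1 (TwistedGroupAlgebra.basis α g • z) = φ g (e.1 z) := fun e z => by
      rw [e.2, TwistedGroupAlgebra.action_basis]
    obtain ⟨z, rfl⟩ : ∃ z, TwistedGroupAlgebra.basis α g • z = y :=
      ⟨(((TwistedGroupAlgebra.unit α g)⁻¹ : (TwistedGroupAlgebra α)ˣ) : TwistedGroupAlgebra α) • y,
        by rw [smul_smul, ← TwistedGroupAlgebra.coe_unit, Units.mul_inv, one_smul]⟩
    rw [hbas, LinearEquiv.symm_apply_apply, hbf, hbas]
  rw [Finset.sum_congr rfl fun g _ => h1 g, Finset.sum_const, Finset.card_univ,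
    ← Nat.cast_smul_eq_nsmul ℂ, smul_smul, inv_mul_cancel₀ hcard, one_smul]

/-! ### Linear independence of the intertwining operators -/

/-- The operators `φ(g)` are linearly independent. In a relation `∑ c_g φ(g) = 0`, apply both sides
to `v_n w`: `∑ c_g (g v)_n φ(g) w = 0`, so `∑ c_g ℓ(g v) φ(g) = 0` for every linear form `ℓ` on `V`.
For a relation of minimal support this forces `ℓ(g v)` to be independent of `g` in the support. -/
theorem linearIndependent_of_isIntertwiningFamily {Y : TwistedModule V (σ : Aut V) M}
    (hY : Y.IsIrreducible) (hV : Module.rank ℂ V ≤ Cardinal.aleph0)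
    (hs : VertexAlgebra.IsSimple V) {φ : G → M ≃ₗ[ℂ] M} (hφ : Y.IsIntertwiningFamily φ) :
    LinearIndependent ℂ fun g => ((φ g : M →ₗ[ℂ] M) : Module.End ℂ M) := by
  classical
  have := Fintype.ofFinite G
  have := hY.1
  have key : ∀ (k : ℕ) (c : G → ℂ), (Finset.univ.filter fun g => c g ≠ 0).card = k →
      (∀ w, ∑ g, c g • φ g w = 0) → c = 0 := by
    intro k
    induction k using Nat.strong_induction_on with
    | _ k ih =>
      intro c hk hc
      by_contra hc0
      obtain ⟨h, hh⟩ := Function.ne_iff.1 hc0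
      have hrel : ∀ (ℓ : Module.Dual ℂ V) (a : V) (w : M),
          ∑ g, (c g * ℓ (((g : Aut V) : V ≃ₗ[ℂ] V) a)) • φ g w = 0 := by
        intro ℓ a w
        have h1 := sum_dual_smul_eq_zero (orderOf_coe_pos σ) hY hV hs
          (y := fun g : G => c g • ((g : Aut V) : V ≃ₗ[ℂ] V) a) (w := fun g => φ g w)
          (fun n => by
            have h2 := hc (Y.mode a n w)
            simpa [hφ.2] using h2) ℓ
        simpa using h1
      have heq : ∀ g, c g ≠ 0 → g = h := by
        intro g hg
        refine Subtype.ext (Subtype.ext (LinearEquiv.ext fun a => ?_))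
        rw [← sub_eq_zero]
        refine (Module.forall_dual_apply_eq_zero_iff ℂ _).1 fun ℓ => ?_
        -- subtracting `ℓ(h a)` times the relation gives one with smaller support
        let d : G → ℂ := fun x =>
          c x * (ℓ (((x : Aut V) : V ≃ₗ[ℂ] V) a) - ℓ (((h : Aut V) : V ≃ₗ[ℂ] V) a))
        have hd : d = 0 := by
          refine ih _ ?_ d rfl fun w => ?_
          · rw [← hk]
            refine Finset.card_lt_card (Finset.ssubset_iff_of_subset (fun x hx => ?_) |>.2
              ⟨h, by simpa using hh, by simp [d]⟩)
            simp only [Finset.mem_filter, Finset.mem_univ, true_and] at hx ⊢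
            exact left_ne_zero_of_mul hx
          · simp only [d, mul_sub, sub_smul, Finset.sum_sub_distrib, hrel, zero_sub, neg_eq_zero]
            have h2 := congrArg (ℓ (((h : Aut V) : V ≃ₗ[ℂ] V) a) • ·) (hc w)
            simpa [Finset.smul_sum, smul_smul, mul_comm] using h2
        rw [map_sub]
        exact (mul_eq_zero.1 (congrFun hd g)).resolve_left hg
      obtain ⟨w, hw⟩ := exists_ne (0 : M)
      have h1 := hc w
      rw [Finset.sum_eq_single h (fun g _ hg => by
        rw [not_not.1 fun h0 => hg (heq g h0), zero_smul]) (by simp)] at h1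
      rcases smul_eq_zero.1 h1 with h2 | h2
      · exact hh h2
      · exact hw ((φ h).map_eq_zero_iff.1 h2)
  refine Fintype.linearIndependent_iff.2 fun c hc => congrFun (key _ c rfl fun w => ?_)
  simpa using LinearMap.congr_fun hc w

end TwistedModule

/-! ### Isotypic decomposition of a module over a semisimple algebra -/

/-- An element `z` of `W ⊗ H` is zero if `(ℓ ⊗ id) z = 0` for all linear forms `ℓ` on `W`. -/
theorem TensorProduct.eq_zero_of_forall_dual_rTensor {W : Type v} {H : Type w} [AddCommGroup W]
    [Module ℂ W] [AddCommGroup H] [Module ℂ H] (z : W ⊗[ℂ] H)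
    (h : ∀ ℓ : Module.Dual ℂ W, TensorProduct.lid ℂ H (ℓ.rTensor H z) = 0) : z = 0 := by
  classical
  let B := Module.Basis.ofVectorSpace ℂ W
  refine (TensorProduct.equivFinsuppOfBasisLeft B).map_eq_zero_iff.1 (Finsupp.ext fun i => ?_)
  rw [TensorProduct.equivFinsuppOfBasisLeft_apply, h, Finsupp.zero_apply]

namespace IrreducibleSystem

variable {A : Type u} [Ring A] [Algebra ℂ A] (𝓦 : IrreducibleSystem.{u, v, w} A)

theorem eq_zero_of_ne {i j : 𝓦.Λ} (hij : i ≠ j) (f : 𝓦.W i →ₗ[A] 𝓦.W j) : f = 0 := by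
  have := 𝓦.irreducible i
  have := 𝓦.irreducible j
  refine f.bijective_or_eq_zero.resolve_left fun h => hij ?_
  exact 𝓦.irredundant i j ⟨LinearEquiv.ofBijective f h⟩

/-- Density on the sum of all irreducible modules: any linear operator on `W_i`, extended by zero to
the other `W_j`, agrees on any given finite set with the action of an element of `A`. -/
theorem exists_smul_eq [Module.Finite ℂ A] [IsSemisimpleRing A] (i : 𝓦.Λ)
    (E : Module.End ℂ (𝓦.W i)) (s : Finset (⨁ j, 𝓦.W j)) :
    ∃ a : A, ∀ z ∈ s, a • z = DirectSum.lof ℂ 𝓦.Λ 𝓦.W i (E (z i)) := by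
  let T : Module.End (Module.End A (⨁ j, 𝓦.W j)) (⨁ j, 𝓦.W j) :=
    { toFun := fun z => DirectSum.lof ℂ 𝓦.Λ 𝓦.W i (E (z i))
      map_add' := fun y z => by rw [DirectSum.add_apply, map_add, map_add]
      map_smul' := fun e z => by
        -- by Schur's lemma, `e` is a scalar on each summand
        have hij : ∀ k j, k ≠ j → ∀ y, e (DirectSum.lof A 𝓦.Λ 𝓦.W k y) j = 0 := by
          intro k j hkj y
          exact LinearMap.congr_fun (𝓦.eq_zero_of_ne hkj (DirectSum.component A 𝓦.Λ 𝓦.W j ∘ₗ e ∘ₗ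
            DirectSum.lof A 𝓦.Λ 𝓦.W k)) y
        have hii : ∃ c : ℂ, ∀ y, e (DirectSum.lof A 𝓦.Λ 𝓦.W i y) i = c • y := by
          have := 𝓦.irreducible i
          obtain ⟨c, hc⟩ := (IsSimpleModule.algebraMap_end_bijective_of_isAlgClosed
            (A := A) (V := 𝓦.W i) ℂ).2 (DirectSum.component A 𝓦.Λ 𝓦.W i ∘ₗ e ∘ₗ
              DirectSum.lof A 𝓦.Λ 𝓦.W i)
          exact ⟨c, fun y => (LinearMap.congr_fun hc y).symm⟩
        obtain ⟨c, hc⟩ := hii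
        have hlof : ∀ y, e (DirectSum.lof ℂ 𝓦.Λ 𝓦.W i y) = DirectSum.lof ℂ 𝓦.Λ 𝓦.W i (c • y) := by
          intro y
          refine DFinsupp.ext fun j => ?_
          by_cases h : i = j
          · subst h
            exact (hc y).trans (DirectSum.lof_apply ℂ i (c • y)).symm
          · refine (hij i j h y).trans ?_
            exact (DirectSum.of_eq_of_ne i j _ (Ne.symm h)).symm
        have hcomp : ∀ z : ⨁ j, 𝓦.W j, (e z) i = c • z i := by
          intro z
          induction z using DirectSum.induction_on with
          | zero => simp
          | of j y =>
            by_cases h : j = i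
            · subst h
              rw [DirectSum.of_eq_same]
              exact hc y
            · rw [DirectSum.of_eq_of_ne j i _ (Ne.symm h), smul_zero]
              exact hij j i h y
          | add y z hy hz => rw [map_add, DirectSum.add_apply, hy, hz, DirectSum.add_apply, smul_add]
        change DirectSum.lof ℂ 𝓦.Λ 𝓦.W i (E ((e z) i)) = e (DirectSum.lof ℂ 𝓦.Λ 𝓦.W i (E (z i)))
        rw [hcomp, hlof, map_smul] }
  obtain ⟨a, ha⟩ := jacobson_density (R := A) T s
  exact ⟨a, fun z hz => (ha z hz).symm⟩

variable {M : Type x} [AddCommGroup M] [Module ℂ M] (ρ : A →ₐ[ℂ] Module.End ℂ M)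

/-- The evaluation map `⨁ W_i ⊗ Hom_A(W_i, M) → M`, `y ⊗ f ↦ f y`. -/
noncomputable def evaluation :
    (⨁ i : 𝓦.Λ, 𝓦.W i ⊗[ℂ] multiplicitySpace ρ (𝓦.W i)) →ₗ[ℂ] M :=
  DirectSum.toModule ℂ 𝓦.Λ M fun i => TensorProduct.lift (multiplicitySpace ρ (𝓦.W i)).subtype.flip

theorem evaluation_of (i : 𝓦.Λ) (y : 𝓦.W i) (f : multiplicitySpace ρ (𝓦.W i)) :
    𝓦.evaluation ρ (DirectSum.of (fun i => 𝓦.W i ⊗[ℂ] multiplicitySpace ρ (𝓦.W i)) i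
      (y ⊗ₜ[ℂ] f)) = f.1 y := by
  rw [evaluation]
  exact (DirectSum.toModule_lof ℂ i _).trans (TensorProduct.lift.tmul _ _)

/-- Induction on the elements of `⨁ W_i ⊗ Hom_A(W_i, M)`. -/
theorem directSum_tmul_induction {p : (⨁ i : 𝓦.Λ, 𝓦.W i ⊗[ℂ] multiplicitySpace ρ (𝓦.W i)) → Prop}
    (zero : p 0) (add : ∀ y z, p y → p z → p (y + z))
    (tmul : ∀ i y f, p (DirectSum.of (fun i => 𝓦.W i ⊗[ℂ] multiplicitySpace ρ (𝓦.W i)) i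
      (y ⊗ₜ[ℂ] f))) (z) : p z := by
  induction z using DirectSum.induction_on with
  | zero => exact zero
  | add y z hy hz => exact add y z hy hz
  | of i t =>
    induction t with
    | zero => rw [map_zero]; exact zero
    | tmul y f => exact tmul i y f
    | add s t hs ht => rw [map_add]; exact add _ _ hs ht

theorem of_smul_tmul (a : A) (i : 𝓦.Λ) (y : 𝓦.W i) (f : multiplicitySpace ρ (𝓦.W i)) :
    a • DirectSum.of (fun i => 𝓦.W i ⊗[ℂ] multiplicitySpace ρ (𝓦.W i)) i (y ⊗ₜ[ℂ] f) =
      DirectSum.of (fun i => 𝓦.W i ⊗[ℂ] multiplicitySpace ρ (𝓦.W i)) i ((a • y) ⊗ₜ[ℂ] f) :=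
  ((DirectSum.lof A 𝓦.Λ (fun i => 𝓦.W i ⊗[ℂ] multiplicitySpace ρ (𝓦.W i)) i).map_smul a
    (y ⊗ₜ[ℂ] f)).symm

theorem evaluation_smul (a : A) (z) : 𝓦.evaluation ρ (a • z) = ρ a (𝓦.evaluation ρ z) := by
  induction z using 𝓦.directSum_tmul_induction ρ with
  | zero => simp
  | add y z hy hz => rw [smul_add, map_add, map_add, map_add, hy, hz]
  | tmul i y f => rw [of_smul_tmul, evaluation_of, evaluation_of, f.2]

theorem evaluation_lmap (T : Module.End ℂ M) (S : ∀ i, Module.End ℂ (multiplicitySpace ρ (𝓦.W i)))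
    (hS : ∀ i f y, (S i f).1 y = T (f.1 y)) (z) :
    𝓦.evaluation ρ (DirectSum.lmap (fun i => (S i).lTensor (𝓦.W i)) z) =
      T (𝓦.evaluation ρ z) := by
  induction z using 𝓦.directSum_tmul_induction ρ with
  | zero => simp
  | add y z hy hz => rw [map_add, map_add, map_add, map_add, hy, hz]
  | tmul i y f =>
    rw [DirectSum.lmap_of, LinearMap.lTensor_tmul, evaluation_of, evaluation_of, hS]

/-- Evaluation is injective: with the density of `A` in the endomorphisms of the `W_i`, an element
of the kernel is annihilated by all rank one operators on all `W_i`. -/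
theorem evaluation_injective [Module.Finite ℂ A] [IsSemisimpleRing A] :
    Function.Injective (𝓦.evaluation ρ) := by
  classical
  rw [← LinearMap.ker_eq_bot, LinearMap.ker_eq_bot']
  intro z hz
  refine DFinsupp.ext fun i => TensorProduct.eq_zero_of_forall_dual_rTensor _ fun ℓ => ?_
  refine Subtype.ext (LinearMap.ext fun y => ?_)
  -- an element of `A` acting on `z` as the rank one operator `ℓ(·) y` on the component `i`
  let R : (⨁ i : 𝓦.Λ, 𝓦.W i ⊗[ℂ] multiplicitySpace ρ (𝓦.W i)) →ₗ[ℂ]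
      𝓦.W i ⊗[ℂ] multiplicitySpace ρ (𝓦.W i) :=
    (ℓ.smulRight y).rTensor _ ∘ₗ DirectSum.component ℂ 𝓦.Λ _ i
  have hfin : ∀ z : ⨁ i : 𝓦.Λ, 𝓦.W i ⊗[ℂ] multiplicitySpace ρ (𝓦.W i),
      ∃ s : Finset (⨁ j, 𝓦.W j), ∀ a : A,
        (∀ t ∈ s, a • t = DirectSum.lof ℂ 𝓦.Λ 𝓦.W i ((ℓ.smulRight y) (t i))) →
        a • z = DirectSum.of _ i (R z) := by
    intro z
    induction z using 𝓦.directSum_tmul_induction ρ with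
    | zero => exact ⟨∅, fun a _ => by simp⟩
    | add p q hp hq =>
      obtain ⟨s, hs⟩ := hp
      obtain ⟨t, ht⟩ := hq
      refine ⟨s ∪ t, fun a ha => ?_⟩
      rw [smul_add, map_add, map_add, hs a fun x hx => ha x (Finset.mem_union_left t hx),
        ht a fun x hx => ha x (Finset.mem_union_right s hx)]
    | tmul j x f =>
      refine ⟨{DirectSum.of 𝓦.W j x}, fun a ha => ?_⟩
      have h1 := ha _ (Finset.mem_singleton_self _)
      have h2 : a • DirectSum.of 𝓦.W j x = DirectSum.of 𝓦.W j (a • x) :=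
        ((DirectSum.lof A 𝓦.Λ 𝓦.W j).map_smul a x).symm
      rw [h2] at h1
      rw [of_smul_tmul]
      by_cases h : j = i
      · subst h
        have h4 := congrArg (fun t : ⨁ j, 𝓦.W j => t j) h1
        simp only [DirectSum.of_eq_same, DirectSum.lof_eq_of] at h4
        rw [h4]
        congr 1
        change _ = (ℓ.smulRight y).rTensor _
          (DirectSum.of (fun i => 𝓦.W i ⊗[ℂ] multiplicitySpace ρ (𝓦.W i)) j (x ⊗ₜ[ℂ] f) j)
        rw [DirectSum.of_eq_same, LinearMap.rTensor_tmul]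
      · have h4 := congrArg (fun t : ⨁ j, 𝓦.W j => t j) h1
        simp only [DirectSum.of_eq_same, DirectSum.lof_eq_of,
          DirectSum.of_eq_of_ne _ _ _ h, DirectSum.of_eq_of_ne _ _ _ (Ne.symm h)] at h4
        have h5 : R (DirectSum.of _ j (x ⊗ₜ[ℂ] f)) = 0 := by
          change (ℓ.smulRight y).rTensor _
            (DirectSum.of (fun i => 𝓦.W i ⊗[ℂ] multiplicitySpace ρ (𝓦.W i)) j (x ⊗ₜ[ℂ] f) i) = 0
          rw [DirectSum.of_eq_of_ne _ _ _ (Ne.symm h), map_zero]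
        rw [h4, h5, TensorProduct.zero_tmul, map_zero, map_zero]
  obtain ⟨s, hs⟩ := hfin z
  obtain ⟨a, ha⟩ := 𝓦.exists_smul_eq i (ℓ.smulRight y) s
  have h1 := 𝓦.evaluation_smul ρ a z
  rw [hz, map_zero, hs a ha] at h1
  have h2 : ∀ t : 𝓦.W i ⊗[ℂ] multiplicitySpace ρ (𝓦.W i),
      𝓦.evaluation ρ (DirectSum.of _ i ((ℓ.smulRight y).rTensor _ t)) =
        (TensorProduct.lid ℂ _ (ℓ.rTensor _ t)).1 y := by
    intro t
    induction t with
    | zero => simp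
    | tmul x f =>
      rw [LinearMap.rTensor_tmul, evaluation_of]
      simp
    | add p q hp hq =>
      rw [map_add, map_add, map_add, hp, hq, map_add, map_add]
      rfl
  exact (h2 (z i)).symm.trans h1

/-- Evaluation is surjective, since `M` is a sum of simple modules. -/
theorem evaluation_surjective [IsSemisimpleRing A] : Function.Surjective (𝓦.evaluation ρ) := by
  let _ : Module A M := Module.compHom M ρ.toRingHom
  have hsmul : ∀ (a : A) (m : M), a • m = ρ a m := fun _ _ => rfl
  have : IsScalarTower ℂ A M := ⟨fun c a m => by
    rw [hsmul, hsmul, map_smul, LinearMap.smul_apply]⟩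
  let R : Submodule A M :=
    { (LinearMap.range (𝓦.evaluation ρ)) with
      smul_mem' := by
        rintro a _ ⟨z, rfl⟩
        exact ⟨a • z, 𝓦.evaluation_smul ρ a z⟩ }
  have hR : R = ⊤ := by
    rw [← top_le_iff, ← IsSemisimpleModule.sSup_simples_eq_top A M]
    refine sSup_le fun S hS => ?_
    obtain ⟨I, hI, ⟨e⟩⟩ := isSimpleModule_iff_quot_maximal.1 hS
    obtain ⟨i, ⟨e'⟩⟩ := 𝓦.complete (A ⧸ I) ((LinearEquiv.isSimpleModule_iff e).1 hS)
    let f : 𝓦.W i →ₗ[A] M := S.subtype ∘ₗ (e.trans e').symm.toLinearMap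
    let f' : multiplicitySpace ρ (𝓦.W i) := ⟨f.restrictScalars ℂ, fun a y => f.map_smul a y⟩
    intro m hm
    refine ⟨DirectSum.of _ i ((e.trans e' ⟨m, hm⟩) ⊗ₜ[ℂ] f'), ?_⟩
    rw [evaluation_of]
    change (((e.trans e').symm (e.trans e' ⟨m, hm⟩) : S) : M) = m
    rw [LinearEquiv.symm_apply_apply]
  intro m
  have h : m ∈ R := hR ▸ trivial
  exact h

/-- If `A` acts faithfully on `M`, every irreducible `A`-module occurs in `M`: it is isomorphic to a
left ideal of `A`, and some vector of `M` is not annihilated by that ideal. -/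
theorem nontrivial_multiplicitySpace [IsSemisimpleRing A] (hρ : Function.Injective ρ) (i : 𝓦.Λ) :
    Nontrivial (multiplicitySpace ρ (𝓦.W i)) := by
  have := 𝓦.irreducible i
  have := IsSimpleModule.nontrivial A (𝓦.W i)
  obtain ⟨y, hy⟩ := exists_ne (0 : 𝓦.W i)
  have := Module.projective_of_isSemisimpleRing A (𝓦.W i)
  obtain ⟨s, hs⟩ := Module.projective_lifting_property (LinearMap.toSpanSingleton A (𝓦.W i) y)
    LinearMap.id (IsSimpleModule.toSpanSingleton_surjective A hy)
  have hsy : s y ≠ 0 := by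
    intro h
    have h1 := LinearMap.congr_fun hs y
    rw [LinearMap.comp_apply, h, map_zero] at h1
    exact hy h1.symm
  obtain ⟨m, hm⟩ : ∃ m, ρ (s y) m ≠ 0 := by
    by_contra! h
    exact hsy ((map_eq_zero_iff ρ hρ).1 (LinearMap.ext h))
  let f : multiplicitySpace ρ (𝓦.W i) :=
    ⟨LinearMap.applyₗ m ∘ₗ ρ.toLinearMap ∘ₗ s.restrictScalars ℂ, fun a z => by
      change ρ (s (a • z)) m = ρ a (ρ (s z) m)
      rw [map_smul, smul_eq_mul, map_mul, Module.End.mul_apply]⟩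
  exact ⟨f, 0, fun h => hm (LinearMap.congr_fun (congrArg Subtype.val h) y)⟩

theorem injective_of_mem_multiplicitySpace {i : 𝓦.Λ} (f : multiplicitySpace ρ (𝓦.W i))
    (hf : f ≠ 0) : Function.Injective f.1 := by
  have := 𝓦.irreducible i
  let K : Submodule A (𝓦.W i) :=
    { LinearMap.ker f.1 with
      smul_mem' := fun a y hy => by
        have hy' : f.1 y = 0 := hy
        change f.1 (a • y) = 0
        rw [f.2, hy', map_zero] }
  have hK : ∀ y, y ∈ K ↔ f.1 y = 0 := fun y => Iff.rfl
  rcases eq_bot_or_eq_top K with h | h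
  · rw [← LinearMap.ker_eq_bot, LinearMap.ker_eq_bot']
    intro y hy
    have h1 := (hK y).2 hy
    rwa [h, Submodule.mem_bot] at h1
  · refine absurd (Subtype.ext (LinearMap.ext fun y => ?_)) hf
    exact (hK y).1 (h ▸ trivial)

end IrreducibleSystem

/-! ### Homomorphisms from a product -/

namespace multiplicitySpace

variable {A : Type u} [Ring A] [Algebra ℂ A] {M : Type v} [AddCommGroup M] [Module ℂ M]
  {ρ : A →ₐ[ℂ] Module.End ℂ M} {W : Type w} [AddCommGroup W] [Module ℂ W] [Module A W]
  {W' : Type x} [AddCommGroup W'] [Module ℂ W'] [Module A W']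

variable (ρ W W') in
/-- Restriction of homomorphisms `W × W' → M` to `W`. -/
def fst : multiplicitySpace ρ (W × W') →ₗ[ℂ] multiplicitySpace ρ W where
  toFun := fun F => ⟨F.1 ∘ₗ LinearMap.inl ℂ _ _, fun a y => by
    have h1 := F.2 a (y, 0)
    rw [Prod.smul_mk, smul_zero] at h1
    exact h1⟩
  map_add' := fun _ _ => rfl
  map_smul' := fun _ _ => rfl

variable (ρ W W') in
/-- Restriction of homomorphisms `W × W' → M` to `W'`. -/
def snd : multiplicitySpace ρ (W × W') →ₗ[ℂ] multiplicitySpace ρ W' where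
  toFun := fun F => ⟨F.1 ∘ₗ LinearMap.inr ℂ _ _, fun a y => by
    have h1 := F.2 a (0, y)
    rw [Prod.smul_mk, smul_zero] at h1
    exact h1⟩
  map_add' := fun _ _ => rfl
  map_smul' := fun _ _ => rfl

/-- The homomorphism `(y, z) ↦ p y + q z`. -/
def coprod (p : multiplicitySpace ρ W) (q : multiplicitySpace ρ W') :
    multiplicitySpace ρ (W × W') :=
  ⟨p.1.coprod q.1, fun a y => by
    rw [LinearMap.coprod_apply, LinearMap.coprod_apply, map_add, ← p.2, ← q.2]; rfl⟩

theorem fst_coprod (p : multiplicitySpace ρ W) (q : multiplicitySpace ρ W') :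
    fst ρ W W' (coprod p q) = p := Subtype.ext (LinearMap.coprod_inl _ _)

theorem snd_coprod (p : multiplicitySpace ρ W) (q : multiplicitySpace ρ W') :
    snd ρ W W' (coprod p q) = q := Subtype.ext (LinearMap.coprod_inr _ _)

theorem coprod_injective [Module.Finite ℂ A] [IsSemisimpleRing A]
    {𝓦 : IrreducibleSystem.{u, w, x} A} {i j : 𝓦.Λ} (hij : i ≠ j)
    {p : multiplicitySpace ρ (𝓦.W i)} (hp : p ≠ 0) {q : multiplicitySpace ρ (𝓦.W j)}
    (hq : q ≠ 0) : Function.Injective (coprod p q).1 := by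
  rw [← LinearMap.ker_eq_bot, LinearMap.ker_eq_bot']
  rintro ⟨y, z⟩ hyz
  let D := fun i => 𝓦.W i ⊗[ℂ] multiplicitySpace ρ (𝓦.W i)
  have h0 : p.1 y + q.1 z = 0 := hyz
  have h1 : DirectSum.of D i (y ⊗ₜ[ℂ] p) + DirectSum.of D j (z ⊗ₜ[ℂ] q) = 0 := by
    refine 𝓦.evaluation_injective ρ ?_
    rw [map_add, 𝓦.evaluation_of, 𝓦.evaluation_of, map_zero, h0]
  have h2 : y ⊗ₜ[ℂ] p = 0 := by
    have h3 := congrArg (fun t : ⨁ i, D i => t i) h1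
    simpa [DirectSum.of_eq_same, DirectSum.of_eq_of_ne _ _ _ hij] using h3
  have h3 : p.1 y = 0 := by
    rw [← 𝓦.evaluation_of ρ, h2, map_zero, map_zero]
  rw [h3, zero_add] at h0
  rw [Prod.mk_eq_zero]
  exact ⟨𝓦.injective_of_mem_multiplicitySpace ρ p hp (h3.trans (map_zero _).symm),
    𝓦.injective_of_mem_multiplicitySpace ρ q hq (h0.trans (map_zero _).symm)⟩

end multiplicitySpace

/-! ### The cocycle of an intertwining family -/

namespace TwistedGroupAlgebra

variable {G : Type u} [Group G] {α : TwoCocycle G} {M : Type v} [AddCommGroup M] [Module ℂ M]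

theorem action_injective {φ : G → M ≃ₗ[ℂ] M} (h1 : φ 1 = 1)
    (hα : ∀ (g h : G) (w : M), φ g (φ h w) = (α.toFun g h : ℂ) • φ (g * h) w)
    (hφ : LinearIndependent ℂ fun g => ((φ g : M →ₗ[ℂ] M) : Module.End ℂ M)) :
    Function.Injective (action φ h1 hα) := by
  intro a b hab
  refine (basis α).repr.injective (hφ ?_)
  have h : ∀ c, action φ h1 hα c = Finsupp.linearCombination ℂ
      (fun g => ((φ g : M →ₗ[ℂ] M) : Module.End ℂ M)) ((basis α).repr c) := fun c =>
    (basis α).constr_apply ℂ _ c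
  rw [← h, ← h, hab]

end TwistedGroupAlgebra

namespace TwistedModule

variable {V : Type u} [AddCommGroup V] [Module ℂ V] [VertexAlgebra V]
  {M : Type v} [AddCommGroup M] [Module ℂ M] {G : Subgroup (Aut V)} {σ : G}

theorem IsStable.exists_isIntertwiningFamily {hσ : σ ∈ Subgroup.center G}
    {Y : TwistedModule V (σ : Aut V) M} (h : IsStable G σ hσ Y) :
    ∃ φ : G → M ≃ₗ[ℂ] M, Y.IsIntertwiningFamily φ := by
  classical
  choose e he using h
  refine ⟨Function.update e 1 1, Function.update_self .., fun g a n w => ?_⟩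
  by_cases hg : g = 1
  · subst hg
    rw [Function.update_self]
    rfl
  · rw [Function.update_of_ne hg]
    exact he g a n w

variable [Finite G]

theorem IsIntertwiningFamily.exists_twoCocycle {Y : TwistedModule V (σ : Aut V) M}
    (hY : Y.IsIrreducible) (hV : Module.rank ℂ V ≤ Cardinal.aleph0) {φ : G → M ≃ₗ[ℂ] M}
    (hφ : Y.IsIntertwiningFamily φ) :
    ∃ α : TwoCocycle G, ∀ (g h : G) (w : M), φ g (φ h w) = (α.toFun g h : ℂ) • φ (g * h) w := by
  have := hY.1
  obtain ⟨w₀, hw₀⟩ := exists_ne (0 : M)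
  have hex : ∀ g h : G, ∃ c : ℂˣ, ∀ w, φ g (φ h w) = (c : ℂ) • φ (g * h) w := by
    intro g h
    obtain ⟨c, hc⟩ := exists_eq_smul_of_commute (orderOf_coe_pos σ) hY hV
      (f := (φ g : M →ₗ[ℂ] M) ∘ₗ (φ h : M →ₗ[ℂ] M) ∘ₗ ((φ (g * h)).symm : M →ₗ[ℂ] M))
      fun a n w => by
        obtain ⟨a, rfl⟩ := (((g * h : G) : Aut V) : V ≃ₗ[ℂ] V).surjective a
        obtain ⟨w, rfl⟩ := (φ (g * h)).surjective w
        simp only [LinearMap.comp_apply, LinearEquiv.coe_coe]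
        rw [← hφ.2, LinearEquiv.symm_apply_apply, LinearEquiv.symm_apply_apply, hφ.2, hφ.2]
        rfl
    have hc' : ∀ w, φ g (φ h w) = c • φ (g * h) w := by
      intro w
      have h1 := hc (φ (g * h) w)
      simpa using h1
    have hc0 : c ≠ 0 := by
      rintro rfl
      have h1 := hc' w₀
      rw [zero_smul] at h1
      exact hw₀ ((φ h).map_eq_zero_iff.1 ((φ g).map_eq_zero_iff.1 h1))
    exact ⟨Units.mk0 c hc0, hc'⟩
  choose α hα using hex
  have huniq : ∀ (g : G) (c d : ℂˣ), (c : ℂ) • φ g w₀ = (d : ℂ) • φ g w₀ → c = d := by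
    intro g c d h
    exact Units.ext (smul_left_injective ℂ
      (fun h0 => hw₀ ((φ g).map_eq_zero_iff.1 h0)) h)
  have hone : ∀ w, φ 1 w = w := fun w => by rw [hφ.1]; rfl
  refine ⟨⟨α, fun g => huniq g _ _ ?_, fun g => huniq g _ _ ?_, fun g h k =>
    huniq (g * h * k) _ _ ?_⟩, hα⟩
  · have h1 := hα 1 g w₀
    rw [hone, one_mul] at h1
    rw [← h1, Units.val_one, one_smul]
  · have h1 := hα g 1 w₀
    rw [hone, mul_one] at h1
    rw [← h1, Units.val_one, one_smul]
  · rw [Units.val_mul, Units.val_mul, mul_smul, mul_smul, ← hα, ← hα, mul_assoc,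
      smul_comm, ← hα, ← map_smul, ← hα]

/-! ### The multiplicity spaces -/

/-- A `V^G`-submodule of `Hom(W, M)` that contains an injective homomorphism is everything. -/
theorem eq_top_of_injective_mem {Y : TwistedModule V (σ : Aut V) M}
    (hY : Y.IsIrreducible) (hV : Module.rank ℂ V ≤ Cardinal.aleph0) {φ : G → M ≃ₗ[ℂ] M}
    (hφ : Y.IsIntertwiningFamily φ) {α : TwoCocycle G}
    (hα : ∀ (g h : G) (w : M), φ g (φ h w) = (α.toFun g h : ℂ) • φ (g * h) w)
    {W : Type w} [AddCommGroup W] [Module ℂ W] [Module (TwistedGroupAlgebra α) W]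
    [FiniteDimensional ℂ W]
    (K : Submodule ℂ (multiplicitySpace (TwistedGroupAlgebra.action φ hφ.1 hα) W))
    (hK : ∀ (a : fixedPoints G) (n : ℚ), ∀ f ∈ K, multiplicityMode _ Y.restrictFixed
      (actionsCommute_action hφ hα) W a n f ∈ K)
    {f : multiplicitySpace (TwistedGroupAlgebra.action φ hφ.1 hα) W} (hfK : f ∈ K)
    (hf : Function.Injective f.1) : K = ⊤ := by
  rw [eq_top_iff]
  intro f' _
  obtain ⟨b, hb, hbf⟩ := exists_modeOperators_restrictFixed_comp_eq hY hV hφ hα f f' hf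
  have h1 : Y.restrictFixed.modeOperators ≤
      (K.map (Submodule.subtype _)).comap (LinearMap.lcomp ℂ M f.1) := by
    refine Submodule.span_le.2 ?_
    rintro _ ⟨⟨a, n⟩, rfl⟩
    exact ⟨_, hK a n f hfK, rfl⟩
  obtain ⟨k, hk, hkf⟩ := h1 hb
  have h2 : k = f' := Subtype.ext (LinearMap.ext fun y =>
    (LinearMap.congr_fun hkf y).trans (hbf y))
  exact h2 ▸ hk

/-- If `Hom(W_i, M)` and `Hom(W_j, M)` are isomorphic `V^G`-modules, then `i = j`. Otherwise, the
graph of an isomorphism is a proper `V^G`-submodule of `Hom(W_i × W_j, M)` that contains an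
injective homomorphism. -/
theorem eq_of_isomorphic {Y : TwistedModule V (σ : Aut V) M}
    (hY : Y.IsIrreducible) (hV : Module.rank ℂ V ≤ Cardinal.aleph0) {φ : G → M ≃ₗ[ℂ] M}
    (hφ : Y.IsIntertwiningFamily φ) {α : TwoCocycle G}
    (hα : ∀ (g h : G) (w : M), φ g (φ h w) = (α.toFun g h : ℂ) • φ (g * h) w)
    [IsSemisimpleRing (TwistedGroupAlgebra α)]
    {𝓦 : IrreducibleSystem.{u, w, x} (TwistedGroupAlgebra α)} {i j : 𝓦.Λ}
    [Nontrivial (multiplicitySpace (TwistedGroupAlgebra.action φ hφ.1 hα) (𝓦.W i))]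
    (h : (multiplicityModule _ Y.restrictFixed (actionsCommute_action hφ hα) (𝓦.W i)).Isomorphic
      (multiplicityModule _ Y.restrictFixed (actionsCommute_action hφ hα) (𝓦.W j))) : i = j := by
  obtain ⟨e, he⟩ := h
  let ρ := TwistedGroupAlgebra.action φ hφ.1 hα
  by_contra hij
  obtain ⟨f, hf⟩ := exists_ne (0 : multiplicitySpace ρ (𝓦.W i))
  have hef : e f ≠ 0 := fun h => hf (e.map_eq_zero_iff.1 h)
  let K : Submodule ℂ (multiplicitySpace ρ (𝓦.W i × 𝓦.W j)) :=
    LinearMap.ker ((e : _ →ₗ[ℂ] _) ∘ₗ multiplicitySpace.fst ρ _ _ - multiplicitySpace.snd ρ _ _)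
  have hK : ∀ F, F ∈ K ↔ e (multiplicitySpace.fst ρ _ _ F) = multiplicitySpace.snd ρ _ _ F :=
    fun F => sub_eq_zero
  have htop : K = ⊤ := by
    refine eq_top_of_injective_mem hY hV hφ hα K (fun a n F hF => ?_)
      ((hK (multiplicitySpace.coprod f (e f))).2 ?_) (multiplicitySpace.coprod_injective hij hf hef)
    · rw [hK] at hF ⊢
      have h1 := he a n (multiplicitySpace.fst ρ _ _ F)
      rw [hF] at h1
      exact h1
    · rw [multiplicitySpace.fst_coprod, multiplicitySpace.snd_coprod]
  have h1 : multiplicitySpace.coprod f 0 ∈ K := htop ▸ trivial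
  rw [hK, multiplicitySpace.fst_coprod, multiplicitySpace.snd_coprod] at h1
  exact hef h1

end TwistedModule

theorem theorem6 {V : Type u} [AddCommGroup V] [Module ℂ V] [VertexAlgebra V]
    (hV : VertexAlgebra.IsSimple V) (hcount : Module.rank ℂ V ≤ Cardinal.aleph0)
    (G : Subgroup (VertexAlgebra.Aut V)) [Finite G] (σ : G) (hσ : σ ∈ Subgroup.center G)
    {M : Type v} [AddCommGroup M] [Module ℂ M]
    (Y : TwistedModule V (σ : VertexAlgebra.Aut V) M)
    (hM : Y.IsIrreducible) (hstable : TwistedModule.IsStable G σ hσ Y) :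
    (∃ φ : G → M ≃ₗ[ℂ] M, Y.IsIntertwiningFamily φ) ∧
    ∀ (φ : G → M ≃ₗ[ℂ] M) (hφ : Y.IsIntertwiningFamily φ),
      ∃ (α : TwoCocycle G)
        (hα : ∀ (g h : G) (w : M), φ g (φ h w) = (α.toFun g h : ℂ) • φ (g * h) w),
        IsSemisimpleRing (TwistedGroupAlgebra α) ∧
        ∀ 𝓦 : IrreducibleSystem.{u, w, x} (TwistedGroupAlgebra α),
          -- the action of `ℂ^α[G]` on `M`, and the `V^G`-module `M_i = Hom(W_i, M)`
          let ρ := TwistedGroupAlgebra.action φ hφ.1 hα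
          let N := fun i : 𝓦.Λ => multiplicityModule ρ Y.restrictFixed
            (actionsCommute_action hφ hα) (𝓦.W i)
          -- the decomposition of `M` as a `ℂ^α[G] ⊗ V^G`-module
          (∃ Θ : (⨁ i : 𝓦.Λ, 𝓦.W i ⊗[ℂ] multiplicitySpace ρ (𝓦.W i)) ≃ₗ[ℂ] M,
            (∀ (i : 𝓦.Λ) (y : 𝓦.W i) (f : multiplicitySpace ρ (𝓦.W i)),
              Θ (DirectSum.of (fun i => 𝓦.W i ⊗[ℂ] multiplicitySpace ρ (𝓦.W i)) i
                (y ⊗ₜ[ℂ] f)) = f.1 y) ∧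
            (∀ (a : TwistedGroupAlgebra α) z, Θ (a • z) = ρ a (Θ z)) ∧
            (∀ (b : VertexAlgebra.fixedPoints G) (n : ℚ) z,
              Θ (DirectSum.lmap (fun i => ((N i).mode b n).lTensor (𝓦.W i)) z) =
                Y.restrictFixed.mode b n (Θ z))) ∧
          (∀ i, Nontrivial (multiplicitySpace ρ (𝓦.W i))) ∧
          (∀ i, (N i).IsIrreducible) ∧
          (∀ i j, (N i).Isomorphic (N j) ↔ i = j) := by
  refine ⟨hstable.exists_isIntertwiningFamily, fun φ hφ => ?_⟩
  obtain ⟨α, hα⟩ := hφ.exists_twoCocycle hM hcount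
  have hss : IsSemisimpleRing (TwistedGroupAlgebra α) :=
    TwistedGroupAlgebra.isSemisimpleModule α
  refine ⟨α, hα, hss, fun 𝓦 => ?_⟩
  intro ρ N
  have hnontriv : ∀ i, Nontrivial (multiplicitySpace ρ (𝓦.W i)) :=
    𝓦.nontrivial_multiplicitySpace ρ (TwistedGroupAlgebra.action_injective hφ.1 hα
      (TwistedModule.linearIndependent_of_isIntertwiningFamily hM hcount hV hφ))
  refine ⟨⟨LinearEquiv.ofBijective (𝓦.evaluation ρ)
    ⟨𝓦.evaluation_injective ρ, 𝓦.evaluation_surjective ρ⟩, 𝓦.evaluation_of ρ,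
    𝓦.evaluation_smul ρ, fun b n =>
      𝓦.evaluation_lmap ρ (Y.restrictFixed.mode b n) (fun i => (N i).mode b n)
        fun _ _ _ => rfl⟩, hnontriv, fun i => ⟨hnontriv i, fun K hK => ?_⟩,
    fun i j => ⟨fun h => ?_, ?_⟩⟩
  · refine or_iff_not_imp_left.2 fun hK0 => ?_
    obtain ⟨f, hfK, hf⟩ := K.exists_mem_ne_zero_of_ne_bot hK0
    exact TwistedModule.eq_top_of_injective_mem hM hcount hφ hα K hK hfK
      (𝓦.injective_of_mem_multiplicitySpace ρ f hf)
  · have := hnontriv i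
    exact TwistedModule.eq_of_isomorphic hM hcount hφ hα h
  · rintro rfl
    exact ⟨LinearEquiv.refl ℂ _, fun _ _ _ => rfl⟩
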